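/- All graphs are finite, simple and undirected. Two vertices $u,v$ of a graph $G$ are \emph{twins} if $N_G(u)\setminus\{v\}=N_G(v)\setminus\{u\}$; this is an equivalence relation on $V(G)$, its classes are the \emph{twin classes} of $G$, and the \emph{neighborhood diversity} $\mathrm{nd}(G)$ is the number of twin classes of $G$. \textsc{Maximum Common Induced Subgraph} is the following decision problem: given graphs $G_1,G_2$ and an integer $h\ge 0$, decide whether there is a graph $H$ with at least $h$ vertices such that both $G_1$ and $G_2$ contain an induced subgraph isomorphic to $H$. \textbf{Theorem.} \textsc{Maximum Common Induced Subgraph} is fixed-parameter tractable parameterized by $\mathrm{nd}(G_1)+\mathrm{nd}(G_2)$. That is, there are an algorithm, a computable function $f\colon\mathbb{N}\to\mathbb{N}$ and a constant $c$ such that the algorithm decides every instance $\langle G_1,G_2,h\rangle$ correctly in at most $f(\mathrm{nd}(G_1)+\mathrm{nd}(G_2))\cdot N^{c}$ steps, where $N$ is the size of the instance (the graphs given by adjacency matrices, $h$ in binary) and steps are those of a random access machine with addition and subtraction at unit cost. -/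

import Mathlib

/-! ### Twins and neighborhood diversity -/

namespace SimpleGraph

variable {V : Type*}

/-- Two vertices are twins if they have the same neighborhood when the adjacency between them is
ignored. -/
def Twins (G : SimpleGraph V) (u v : V) : Prop :=
  G.neighborSet u \ {v} = G.neighborSet v \ {u}

theorem twins_iff (G : SimpleGraph V) (u v : V) :
    G.Twins u v ↔ ∀ w, w ≠ u → w ≠ v → (G.Adj u w ↔ G.Adj v w) := by
  unfold Twins
  rw [Set.ext_iff]
  constructor
  · intro h w hu hv
    simpa [hu, hv] using h w
  · intro h w
    by_cases hu : w = u
    · subst hu; simp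
    · by_cases hv : w = v
      · subst hv; simp
      · simpa [hu, hv] using h w hu hv

theorem twins_equivalence (G : SimpleGraph V) : Equivalence G.Twins where
  refl _ := rfl
  symm h := Eq.symm h
  trans := by
    intro a b c hab hbc
    rw [twins_iff] at *
    intro w ha hc
    by_cases hb : w = b
    · subst hb
      by_cases hac : a = c
      · subst hac; rfl
      · have h1 := hab c (Ne.symm hac) (Ne.symm hc)
        have h2 := hbc a (Ne.symm ha) hac
        rw [G.adj_comm a w, h2, G.adj_comm c a, h1, G.adj_comm w c]
    · exact (hab w ha hb).trans (hbc w hb hc)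

/-- The twin classes of a graph are the classes of this equivalence relation. -/
def twinSetoid (G : SimpleGraph V) : Setoid V := ⟨G.Twins, G.twins_equivalence⟩

/-- The neighborhood diversity: the number of twin classes. -/
noncomputable def nd (G : SimpleGraph V) : ℕ := Nat.card (Quotient G.twinSetoid)

end SimpleGraph

/-! ### Random access machines

The additive RAM with uniform cost: registers hold natural numbers, are addressed directly or
indirectly, and are all `0` at the start; the input is a finite list of natural numbers with
read-only random access. Every instruction costs one step. There is no multiplication, so that `t`
steps can lengthen the binary representation of numbers by at most `O(t)` bits, and running times
agree with those of Turing machines up to a polynomial. -/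

namespace RAM

/-- The instructions; `R` is the register file, `x` the input. -/
inductive Instr where
  /-- `R[d] := c` -/
  | const (d c : ℕ)
  /-- `R[d] := R[a]` -/
  | copy (d a : ℕ)
  /-- `R[d] := R[a] + R[b]` -/
  | add (d a b : ℕ)
  /-- `R[d] := max (R[a] - R[b]) 0` -/
  | sub (d a b : ℕ)
  /-- `R[d] := R[R[a]]` -/
  | load (d a : ℕ)
  /-- `R[R[d]] := R[a]` -/
  | store (d a : ℕ)
  /-- `R[d] := x[R[a]]`, which is `0` beyond the end of the input -/
  | read (d a : ℕ)
  /-- `R[d] :=` the number of entries of the input -/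
  | len (d : ℕ)
  /-- go to instruction number `l` -/
  | jump (l : ℕ)
  /-- go to instruction number `l` if `R[a] = 0` -/
  | jz (a l : ℕ)

/-- A program is a finite list of instructions, numbered from `0`. -/
abbrev Program := List Instr

/-- A configuration: the program counter and the contents of the registers. -/
structure Cfg where
  pc : ℕ
  reg : ℕ → ℕ

/-- Write `v` into register `d` and go on to the next instruction. -/
def Cfg.write (s : Cfg) (d v : ℕ) : Cfg := ⟨s.pc + 1, Function.update s.reg d v⟩

/-- The effect of one instruction on a configuration, on input `x`. -/
def Instr.exec (x : List ℕ) (s : Cfg) : Instr → Cfg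
  | const d c => s.write d c
  | copy d a => s.write d (s.reg a)
  | add d a b => s.write d (s.reg a + s.reg b)
  | sub d a b => s.write d (s.reg a - s.reg b)
  | load d a => s.write d (s.reg (s.reg a))
  | store d a => s.write (s.reg d) (s.reg a)
  | read d a => s.write d (x.getD (s.reg a) 0)
  | len d => s.write d x.length
  | jump l => ⟨l, s.reg⟩
  | jz a l => ⟨if s.reg a = 0 then l else s.pc + 1, s.reg⟩

/-- One step of the program `P` on input `x`. Configurations whose program counter points outside
the program are halted. -/
def step (P : Program) (x : List ℕ) (s : Cfg) : Cfg :=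
  match P[s.pc]? with
  | some i => i.exec x s
  | none => s

/-- The configuration after `t` steps of the program `P` on input `x`. -/
def run (P : Program) (x : List ℕ) (t : ℕ) : Cfg := (step P x)^[t] ⟨0, fun _ => 0⟩

/-- On input `x` the program `P` halts after at most `T` steps, with output `b` in register `0`. -/
def OutputsWithin (P : Program) (x : List ℕ) (b T : ℕ) : Prop :=
  ∃ t ≤ T, P.length ≤ (run P x t).pc ∧ (run P x t).reg 0 = b

/-- The size of an input: the total binary length of its entries, plus one for each entry. -/
def inputSize (x : List ℕ) : ℕ := (x.map fun a => Nat.size a + 1).sum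

end RAM

/-- The decision problem with instances `I`, encoded by `enc`, and yes-instances `Yes` is
fixed-parameter tractable parameterized by `κ`: one algorithm decides every instance `i` in time
`f (κ i) * |i| ^ c`, for a computable function `f` and a constant `c`. -/
def IsFPT {I : Type} (enc : I → List ℕ) (Yes : I → Prop) (κ : I → ℕ) : Prop :=
  ∃ (P : RAM.Program) (f : ℕ → ℕ) (c : ℕ), Computable f ∧ ∀ i : I,
    (Yes i → RAM.OutputsWithin P (enc i) 1 (f (κ i) * RAM.inputSize (enc i) ^ c)) ∧
    (¬ Yes i → RAM.OutputsWithin P (enc i) 0 (f (κ i) * RAM.inputSize (enc i) ^ c))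

/-! ### Maximum Common Induced Subgraph -/

/-- An instance: two finite simple graphs and a number `h`. -/
structure MCISInstance where
  n₁ : ℕ
  n₂ : ℕ
  G₁ : SimpleGraph (Fin n₁)
  G₂ : SimpleGraph (Fin n₂)
  h : ℕ

open Classical in
/-- The adjacency matrix, row by row: entry number `k = n * i + j` belongs to the vertices
`i = k / n` and `j = k % n`. -/
noncomputable def adjBits {n : ℕ} (G : SimpleGraph (Fin n)) : List ℕ :=
  List.ofFn fun k : Fin (n * n) => if G.Adj k.divNat k.modNat then 1 else 0

namespace MCISInstance

/-- The encoding of an instance: the numbers of vertices, `h`, and the adjacency matrices. -/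
noncomputable def encode (i : MCISInstance) : List ℕ :=
  [i.n₁, i.n₂, i.h] ++ adjBits i.G₁ ++ adjBits i.G₂

/-- There is a graph with at least `h` vertices that is isomorphic to an induced subgraph of `G₁`
and to an induced subgraph of `G₂`. -/
def IsYes (i : MCISInstance) : Prop :=
  ∃ (m : ℕ) (H : SimpleGraph (Fin m)),
    i.h ≤ m ∧ H.IsIndContained i.G₁ ∧ H.IsIndContained i.G₂

end MCISInstance

/-! Two graphs have a common induced subgraph with `h` vertices if and only if there is a list of
`h` pairs of vertices, one from each graph, that are pairwise *compatible*: distinct in both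
coordinates and adjacent in both graphs or in neither. Since twins can be exchanged for each other,
the compatibility of two pairs that are distinct in both coordinates depends only on the twin
classes. Hence, once the pairs of classes `(i, j)` that occur are known, an optimal list is limited
only by the sizes of the classes, except that a clique and an independent set of twins contribute
at most one pair.

For all other `(i, j)`, the numbers of entries form a point of a transportation polytope. Their sum
is maximal at an extreme point, and at an extreme point some entry is `0` or exhausts its row or its
column. In the latter case nothing is lost by greedily appending as many pairs from the classes
`(i, j)` as possible. By induction, a suitable sequence of greedy phases leads to an optimal list.
It is no longer than the product of the neighborhood diversities, so all such sequences can be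
tried.

The algorithm is written in a small language of bounded loops, which is compiled to the random
access machine. In each stage, no variable that bounds a loop is written to, so the running time is
bounded by a polynomial in the initial values of these variables. -/

/-! ### A language of bounded loops and its compilation to random access machines -/

namespace LoopLang

open RAM

/-- The states of the language of bounded loops: scalar variables and eight unbounded arrays of
natural numbers. -/
structure St where
  v : ℕ → ℕ
  a : Fin 8 → ℕ → ℕ

namespace St

/-- Assignment to a variable. -/
def setV (s : St) (i n : ℕ) : St := ⟨Function.update s.v i n, s.a⟩

/-- Assignment to an array cell. -/
def setA (s : St) (k : Fin 8) (i n : ℕ) : St :=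
  ⟨s.v, Function.update s.a k (Function.update (s.a k) i n)⟩

@[simp] theorem setV_a (s : St) (i n : ℕ) : (s.setV i n).a = s.a := rfl

@[simp] theorem setA_v (s : St) (k : Fin 8) (i n : ℕ) : (s.setA k i n).v = s.v := rfl

@[simp] theorem setV_v_self (s : St) (i n : ℕ) : (s.setV i n).v i = n := by simp [setV]

theorem setV_v_of_ne (s : St) {i j : ℕ} (n : ℕ) (h : j ≠ i) : (s.setV i n).v j = s.v j := by
  simp [setV, h]

theorem setA_a (s : St) (k : Fin 8) (i n : ℕ) (l : Fin 8) (j : ℕ) :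
    (s.setA k i n).a l j = if l = k ∧ j = i then n else s.a l j := by
  by_cases h : l = k
  · subst h; simp [setA, Function.update_apply]
  · simp [setA, h]

theorem setA_a_of_ne (s : St) {k l : Fin 8} (i n : ℕ) (h : l ≠ k) :
    (s.setA k i n).a l = s.a l := by
  simp [setA, h]

/-- The state after `n` rounds of a loop with counter `i` and a body with effect `f`. -/
def rounds (f : St → St) (i : ℕ) (s : St) : ℕ → St
  | 0 => s
  | n + 1 => f ((rounds f i s n).setV i n)

/-- The state in which commands are started: everything is `0`. -/
def start : St := ⟨fun _ => 0, fun _ _ => 0⟩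

end St

/-- Expressions. Subtraction is truncated; `arr k e` is cell number `e` of array `k`, and `inp e`
is entry number `e` of the input. As a condition, an expression counts as true if its value is
`0`. -/
inductive Expr where
  | lit (n : ℕ)
  | var (i : ℕ)
  | add (e f : Expr)
  | sub (e f : Expr)
  | arr (k : Fin 8) (e : Expr)
  | inp (e : Expr)

namespace Expr

/-- The value of an expression on input `x` in state `s`. -/
@[simp] def eval (x : List ℕ) (s : St) : Expr → ℕ
  | lit n => n
  | var i => s.v i
  | add e f => e.eval x s + f.eval x s
  | sub e f => e.eval x s - f.eval x s
  | arr k e => s.a k (e.eval x s)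
  | inp e => x.getD (e.eval x s) 0

/-- The number of steps that the evaluation takes, which is also the length of the code. -/
def size : Expr → ℕ
  | lit _ => 1
  | var _ => 1
  | add e f => e.size + f.size + 1
  | sub e f => e.size + f.size + 1
  | arr _ e => e.size + 7
  | inp e => e.size + 1

instance : Add Expr := ⟨add⟩

@[simp] theorem eval_add (x : List ℕ) (s : St) (e f : Expr) :
    (e + f).eval x s = e.eval x s + f.eval x s := rfl

/-- The condition `e = f`. -/
def eq (e f : Expr) : Expr := (e.sub f).add (f.sub e)

/-- The condition `e < f`. -/
def lt (e f : Expr) : Expr := (e + lit 1).sub f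

/-- The conjunction of two conditions. -/
def and (e f : Expr) : Expr := e + f

/-- The negation of a condition. -/
def not (e : Expr) : Expr := (lit 1).sub e

/-- The condition `e` is true on input `x` in state `s`. -/
def Holds (x : List ℕ) (s : St) (e : Expr) : Prop := e.eval x s = 0

instance (x : List ℕ) (s : St) (e : Expr) : Decidable (e.Holds x s) :=
  inferInstanceAs (Decidable (_ = 0))

variable (x : List ℕ) (s : St) (e f : Expr)

@[simp] theorem holds_eq : (e.eq f).Holds x s ↔ e.eval x s = f.eval x s := by
  simp only [Holds, eq, eval]; omega

@[simp] theorem holds_lt : (e.lt f).Holds x s ↔ e.eval x s < f.eval x s := by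
  simp only [Holds, lt, eval]; omega

@[simp] theorem holds_and : (e.and f).Holds x s ↔ e.Holds x s ∧ f.Holds x s := by
  simp only [Holds, and, eval_add]; omega

@[simp] theorem holds_not : e.not.Holds x s ↔ ¬ e.Holds x s := by
  simp only [Holds, not, eval]; omega

end Expr

/-- Commands. `ite e c c'` runs `c` if the condition `e` is true and `c'` otherwise; `loop i z c`
runs `c` with `0, 1, 2, …` in variable `i`, as often as the initial value of variable `z` says. -/
inductive Cmd where
  | skip
  | set (i : ℕ) (e : Expr)
  | put (k : Fin 8) (e f : Expr)
  | seq (c c' : Cmd)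
  | ite (e : Expr) (c c' : Cmd)
  | loop (i z : ℕ) (c : Cmd)

notation:60 c:61 ";;" e:60 => Cmd.seq c e

namespace Cmd

/-- The effect of a command on input `x`. -/
def eval (x : List ℕ) : Cmd → St → St
  | skip, s => s
  | set i e, s => s.setV i (e.eval x s)
  | put k e f, s => s.setA k (e.eval x s) (f.eval x s)
  | seq c c', s => c'.eval x (c.eval x s)
  | ite e c c', s => if e.Holds x s then c.eval x s else c'.eval x s
  | loop i z c, s => s.rounds (c.eval x) i (s.v z)

/-- The number of steps that the compiled command takes. -/
def cost (x : List ℕ) : Cmd → St → ℕ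
  | skip, _ => 0
  | set _ e, _ => e.size + 1
  | put _ e f, _ => e.size + f.size + 7
  | seq c c', s => c.cost x s + c'.cost x (c.eval x s)
  | ite e c c', s => e.size + 1 + if e.Holds x s then c.cost x s else c'.cost x s + 1
  | loop i z c, s =>
      4 + ∑ j ∈ Finset.range (s.v z), (6 + c.cost x ((s.rounds (c.eval x) i j).setV i j))

end Cmd

/-! #### The compiler -/

/-- The register of temporary number `d`. Registers `16 * i` hold variables, `16 * i + 1` hold
temporaries, and `16 * i + (2 + k)` is cell number `i` of array `k`. -/
abbrev tmp (d : ℕ) : ℕ := 16 * d + 1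

/-- The register of variable number `i`. -/
abbrev vreg (i : ℕ) : ℕ := 16 * i

/-- Code that replaces an index in temporary `d` by the register of that cell of array `k`: four
doublings followed by an addition. -/
def addrCode (k : Fin 8) (d : ℕ) : List Instr :=
  [.add (tmp d) (tmp d) (tmp d), .add (tmp d) (tmp d) (tmp d), .add (tmp d) (tmp d) (tmp d),
    .add (tmp d) (tmp d) (tmp d), .const (tmp (d + 1)) (2 + k),
    .add (tmp d) (tmp d) (tmp (d + 1))]

/-- Code that puts the value of an expression into temporary `d`. -/
def Expr.compile : Expr → ℕ → List Instr
  | lit n, d => [.const (tmp d) n]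
  | var i, d => [.copy (tmp d) (vreg i)]
  | add e f, d => e.compile d ++ (f.compile (d + 1) ++ [.add (tmp d) (tmp d) (tmp (d + 1))])
  | sub e f, d => e.compile d ++ (f.compile (d + 1) ++ [.sub (tmp d) (tmp d) (tmp (d + 1))])
  | arr k e, d => e.compile d ++ (addrCode k d ++ [.load (tmp d) (tmp d)])
  | inp e, d => e.compile d ++ [.read (tmp d) (tmp d)]

/-- The number of instructions of a compiled command. -/
def Cmd.len : Cmd → ℕ
  | skip => 0
  | set _ e => e.size + 1
  | put _ e f => e.size + (6 + (f.size + 1))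
  | seq c c' => c.len + c'.len
  | ite e c c' => e.size + (1 + (c'.len + (1 + c.len)))
  | loop _ _ c => 5 + (c.len + 3)

/-- The code of a command, for position `o` of a program; temporaries below `d` are kept. A loop
keeps its number of rounds in temporary `d` and counts in temporary `d + 1`. -/
def Cmd.compile : Cmd → ℕ → ℕ → List Instr
  | skip, _, _ => []
  | set i e, d, _ => e.compile d ++ [.copy (vreg i) (tmp d)]
  | put k e f, d, _ =>
      e.compile d ++ (addrCode k d ++ (f.compile (d + 1) ++ [.store (tmp d) (tmp (d + 1))]))
  | seq c c', d, o => c.compile d o ++ c'.compile d (o + c.len)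
  | ite e c c', d, o =>
      e.compile d ++ ([.jz (tmp d) (o + e.size + 1 + c'.len + 1)] ++
        (c'.compile d (o + e.size + 1) ++ ([.jump (o + e.size + 1 + c'.len + 1 + c.len)] ++
          c.compile d (o + e.size + 1 + c'.len + 1))))
  | loop i z c, d, o =>
      [.copy (tmp d) (vreg z), .const (tmp (d + 1)) 0,
        .sub (tmp (d + 2)) (tmp d) (tmp (d + 1)), .jz (tmp (d + 2)) (o + (5 + (c.len + 3))),
        .copy (vreg i) (tmp (d + 1))] ++ (c.compile (d + 2) (o + 5) ++
        [.const (tmp (d + 2)) 1, .add (tmp (d + 1)) (tmp (d + 1)) (tmp (d + 2)), .jump (o + 2)])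

theorem Expr.length_compile (e : Expr) (d : ℕ) : (e.compile d).length = e.size := by
  induction e generalizing d with
  | lit | var => rfl
  | add e f he hf | sub e f he hf => simp [compile, size, he, hf]; omega
  | arr k e he => simp [compile, size, he, addrCode]
  | inp e he => simp [compile, size, he]

theorem Cmd.length_compile (c : Cmd) (d o : ℕ) : (c.compile d o).length = c.len := by
  induction c generalizing d o with
  | skip => rfl
  | set => simp [compile, len, Expr.length_compile]
  | put => simp [compile, len, Expr.length_compile, addrCode]; omega
  | seq c c' h h' => simp [compile, len, h, h']
  | ite e c c' h h' => simp [compile, len, h, h', Expr.length_compile]; omega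
  | loop i z c h => simp [compile, len, h]; omega

/-- The code `l` stands at position `o` of the program `P`. -/
def CodeAt (P : Program) (o : ℕ) (l : List Instr) : Prop := l <+: P.drop o

theorem codeAt_append {P : Program} {o : ℕ} {l l' : List Instr} :
    CodeAt P o (l ++ l') ↔ CodeAt P o l ∧ CodeAt P (o + l.length) l' := by
  constructor
  · rintro ⟨m, hm⟩
    refine ⟨⟨l' ++ m, by rw [← hm, List.append_assoc]⟩, ⟨m, ?_⟩⟩
    rw [← List.drop_drop, ← hm, List.append_assoc, List.drop_left]
  · rintro ⟨⟨m, hm⟩, h'⟩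
    rw [CodeAt, ← List.drop_drop, ← hm, List.drop_left] at h'
    rw [CodeAt, ← hm]
    exact (List.prefix_append_right_inj l).2 h'

theorem codeAt_cons {P : Program} {o : ℕ} {i : Instr} {l : List Instr} :
    CodeAt P o (i :: l) ↔ P[o]? = some i ∧ CodeAt P (o + 1) l := by
  rw [← List.singleton_append, codeAt_append]
  refine and_congr ?_ Iff.rfl
  rw [CodeAt, List.singleton_prefix_iff_head?_eq_some, List.head?_drop]

/-- In `t` steps the machine comes from program counter `pc` and registers `r` to program counter
`pc'` and registers `r'`. -/
def Runs (P : Program) (x : List ℕ) (t pc : ℕ) (r : ℕ → ℕ) (pc' : ℕ) (r' : ℕ → ℕ) : Prop :=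
  (step P x)^[t] ⟨pc, r⟩ = ⟨pc', r'⟩

section Correctness

variable {P : Program} {x : List ℕ}

theorem Runs.refl (pc : ℕ) (r : ℕ → ℕ) : Runs P x 0 pc r pc r := rfl

theorem Runs.trans {t t' p p' p'' : ℕ} {r r' r'' : ℕ → ℕ}
    (h : Runs P x t p r p' r') (h' : Runs P x t' p' r' p'' r'') :
    Runs P x (t + t') p r p'' r'' := by
  unfold Runs at *
  rw [add_comm, Function.iterate_add_apply, h, h']

theorem Runs.instr {p : ℕ} {i : Instr} (h : P[p]? = some i)
    (r : ℕ → ℕ) : Runs P x 1 p r (i.exec x ⟨p, r⟩).pc (i.exec x ⟨p, r⟩).reg := by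
  simp [Runs, step, h]

theorem Runs.cast {t t' p p' q : ℕ} {r r' : ℕ → ℕ}
    (h : Runs P x t p r p' r') (ht : t = t') (hp : p' = q) : Runs P x t' p r q r' := by
  subst ht hp; exact h

/-- The registers `r` represent the state `s`. -/
def Rep (r : ℕ → ℕ) (s : St) : Prop :=
  (∀ i, r (vreg i) = s.v i) ∧ ∀ (k : Fin 8) i, r (16 * i + (2 + k)) = s.a k i

theorem Rep.update_tmp {r : ℕ → ℕ} {s : St} (h : Rep r s) (d n : ℕ) :
    Rep (Function.update r (tmp d) n) s := by
  refine ⟨fun i => ?_, fun k i => ?_⟩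
  · rw [Function.update_of_ne (by simp only [tmp, vreg]; omega), h.1]
  · rw [Function.update_of_ne (by simp only [tmp]; omega), h.2]

theorem Rep.update_vreg {r : ℕ → ℕ} {s : St} (h : Rep r s) (i n : ℕ) :
    Rep (Function.update r (vreg i) n) (s.setV i n) := by
  refine ⟨fun j => ?_, fun k j => ?_⟩
  · by_cases hj : j = i
    · subst hj; simp
    · rw [Function.update_of_ne (by simp only [vreg]; omega), h.1, St.setV_v_of_ne _ _ hj]
  · rw [Function.update_of_ne (by simp only [vreg]; omega), h.2, St.setV_a]

theorem Rep.update_cell {r : ℕ → ℕ} {s : St} (h : Rep r s) (k : Fin 8) (i n : ℕ) :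
    Rep (Function.update r (16 * i + (2 + k)) n) (s.setA k i n) := by
  refine ⟨fun j => ?_, fun l j => ?_⟩
  · rw [Function.update_of_ne (by simp only [vreg]; omega), h.1, St.setA_v]
  · rw [St.setA_a]
    by_cases hj : l = k ∧ j = i
    · rw [if_pos hj, hj.1, hj.2, Function.update_self]
    · rw [if_neg hj, Function.update_of_ne, h.2]
      intro he
      exact hj ⟨Fin.ext (by omega), by omega⟩

/-- The temporaries below `d` agree. -/
def Keep (d : ℕ) (r r' : ℕ → ℕ) : Prop := ∀ j < d, r' (tmp j) = r (tmp j)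

theorem Keep.refl (d : ℕ) (r : ℕ → ℕ) : Keep d r r := fun _ _ => rfl

theorem Keep.trans {d : ℕ} {r r' r'' : ℕ → ℕ} (h : Keep d r r') (h' : Keep d r' r'') :
    Keep d r r'' := fun j hj => (h' j hj).trans (h j hj)

theorem Keep.mono {d d' : ℕ} {r r' : ℕ → ℕ} (h : Keep d r r') (hd : d' ≤ d) : Keep d' r r' :=
  fun j hj => h j (hj.trans_le hd)

theorem Keep.update_tmp {d d' : ℕ} {r r' : ℕ → ℕ} (h : Keep d r r') (hd : d ≤ d') (n : ℕ) :
    Keep d r (Function.update r' (tmp d') n) := by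
  intro j hj
  rw [Function.update_of_ne (by simp only [tmp]; omega), h j hj]

theorem Keep.update_vreg {d : ℕ} {r r' : ℕ → ℕ} (h : Keep d r r') (i n : ℕ) :
    Keep d r (Function.update r' (vreg i) n) := by
  intro j hj
  rw [Function.update_of_ne (by simp only [tmp, vreg]; omega), h j hj]

theorem Keep.update_cell {d : ℕ} {r r' : ℕ → ℕ} (h : Keep d r r') (k : Fin 8) (i n : ℕ) :
    Keep d r (Function.update r' (16 * i + (2 + k)) n) := by
  intro j hj
  rw [Function.update_of_ne (by simp only [tmp]; omega), h j hj]

theorem runs_addrCode {o d : ℕ} {k : Fin 8} {r : ℕ → ℕ} {s : St}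
    (hc : CodeAt P o (addrCode k d)) (hr : Rep r s) :
    ∃ r', Runs P x 6 o r (o + 6) r' ∧ Rep r' s ∧ Keep d r r' ∧
      r' (tmp d) = 16 * r (tmp d) + (2 + k) := by
  simp only [addrCode, codeAt_cons] at hc
  obtain ⟨h1, h2, h3, h4, h5, h6, -⟩ := hc
  refine ⟨_, ((((((Runs.instr h1 r).trans (Runs.instr h2 _)).trans (Runs.instr h3 _)).trans
    (Runs.instr h4 _)).trans (Runs.instr h5 _)).trans (Runs.instr h6 _)).cast rfl rfl,
    ?_, ?_, ?_⟩
  · exact (((((hr.update_tmp _ _).update_tmp _ _).update_tmp _ _).update_tmp _ _).update_tmp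
      _ _).update_tmp _ _
  · exact ((((((Keep.refl d r).update_tmp le_rfl _).update_tmp le_rfl _).update_tmp le_rfl
      _).update_tmp le_rfl _).update_tmp (Nat.le_succ d) _).update_tmp le_rfl _
  · have : tmp d ≠ tmp (d + 1) := by simp [tmp]
    simp only [Instr.exec, Cfg.write, Function.update_self, Function.update_of_ne this]
    omega

theorem Expr.runs_compile (e : Expr) {o d : ℕ} {r : ℕ → ℕ} {s : St}
    (hc : CodeAt P o (e.compile d)) (hr : Rep r s) :
    ∃ r', Runs P x e.size o r (o + e.size) r' ∧ Rep r' s ∧ Keep d r r' ∧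
      r' (tmp d) = e.eval x s := by
  induction e generalizing o d r with
  | lit n =>
    simp only [compile, codeAt_cons] at hc
    exact ⟨_, Runs.instr hc.1 r, hr.update_tmp _ _, (Keep.refl d r).update_tmp le_rfl _,
      by simp [Instr.exec, Cfg.write]⟩
  | var i =>
    simp only [compile, codeAt_cons] at hc
    exact ⟨_, Runs.instr hc.1 r, hr.update_tmp _ _, (Keep.refl d r).update_tmp le_rfl _,
      by simp only [Instr.exec, Cfg.write, Function.update_self, eval, hr.1]⟩
  | add e f he hf | sub e f he hf =>
    simp only [compile, codeAt_append, codeAt_cons, length_compile] at hc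
    obtain ⟨hc1, hc2, hc3, -⟩ := hc
    obtain ⟨r1, h1, hr1, hk1, hv1⟩ := he hc1 hr
    obtain ⟨r2, h2, hr2, hk2, hv2⟩ := hf hc2 hr1
    refine ⟨_, ((h1.trans h2).trans (Runs.instr hc3 r2)).cast rfl ?_, hr2.update_tmp _ _,
      (hk1.trans (hk2.mono (Nat.le_succ d))).update_tmp le_rfl _, ?_⟩
    · simp only [Instr.exec, Cfg.write, size]; omega
    · simp only [Instr.exec, Cfg.write, Function.update_self, eval, hv2, hk2 d (Nat.lt_succ_self d),
        hv1]
  | arr k e he =>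
    simp only [compile, codeAt_append, codeAt_cons, length_compile] at hc
    obtain ⟨hc1, hc2, hc3, -⟩ := hc
    obtain ⟨r1, h1, hr1, hk1, hv1⟩ := he hc1 hr
    obtain ⟨r2, h2, hr2, hk2, hv2⟩ := runs_addrCode (x := x) hc2 hr1
    refine ⟨_, ((h1.trans h2).trans (Runs.instr hc3 r2)).cast rfl ?_, hr2.update_tmp _ _,
      (hk1.trans hk2).update_tmp le_rfl _, ?_⟩
    · simp only [Instr.exec, Cfg.write, size, addrCode, List.length_cons, List.length_nil]; omega
    · simp only [Instr.exec, Cfg.write, Function.update_self, eval, hv2, hv1, hr2.2]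
  | inp e he =>
    simp only [compile, codeAt_append, codeAt_cons, length_compile] at hc
    obtain ⟨hc1, hc2, -⟩ := hc
    obtain ⟨r1, h1, hr1, hk1, hv1⟩ := he hc1 hr
    refine ⟨_, (h1.trans (Runs.instr hc2 r1)).cast rfl ?_, hr1.update_tmp _ _,
      hk1.update_tmp le_rfl _, ?_⟩
    · simp only [Instr.exec, Cfg.write, size]; omega
    · simp only [Instr.exec, Cfg.write, Function.update_self, eval, hv1]

/-- The compiled command does what the command does, in as many steps as it costs. -/
def Cmd.Correct (P : Program) (x : List ℕ) (c : Cmd) : Prop :=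
  ∀ {o d : ℕ} {r : ℕ → ℕ} {s : St}, CodeAt P o (c.compile d o) → Rep r s →
    ∃ r', Runs P x (c.cost x s) o r (o + c.len) r' ∧ Rep r' (c.eval x s) ∧ Keep d r r'

namespace Cmd

theorem correct_set (i : ℕ) (e : Expr) : Correct P x (set i e) := by
  intro o d r s hc hr
  simp only [compile, codeAt_append, codeAt_cons, Expr.length_compile] at hc
  obtain ⟨r1, h1, hr1, hk1, hv1⟩ := e.runs_compile (x := x) hc.1 hr
  refine ⟨_, (h1.trans (Runs.instr hc.2.1 r1)).cast rfl (by rfl), ?_, ?_⟩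
  · simp only [Instr.exec, Cfg.write, hv1]
    exact hr1.update_vreg _ _
  · exact hk1.update_vreg _ _

theorem correct_put (k : Fin 8) (e f : Expr) : Correct P x (put k e f) := by
  intro o d r s hc hr
  simp only [compile, codeAt_append, codeAt_cons, Expr.length_compile] at hc
  obtain ⟨hc1, hc2, hc3, hc4, -⟩ := hc
  obtain ⟨r1, h1, hr1, hk1, hv1⟩ := e.runs_compile (x := x) hc1 hr
  obtain ⟨r2, h2, hr2, hk2, hv2⟩ := runs_addrCode (x := x) hc2 hr1
  obtain ⟨r3, h3, hr3, hk3, hv3⟩ := f.runs_compile (x := x) hc3 hr2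
  refine ⟨_, (((h1.trans h2).trans h3).trans (Runs.instr hc4 r3)).cast ?_ ?_, ?_, ?_⟩
  · simp only [cost]; omega
  · simp only [Instr.exec, Cfg.write, len, addrCode, List.length_cons, List.length_nil]; omega
  · simp only [Instr.exec, Cfg.write, hv3, hk3 d (Nat.lt_succ_self d), hv2, hv1]
    exact hr3.update_cell _ _ _
  · simp only [Instr.exec, Cfg.write, hv3, hk3 d (Nat.lt_succ_self d), hv2, hv1]
    exact ((hk1.trans hk2).trans (hk3.mono (Nat.le_succ d))).update_cell _ _ _

theorem Correct.seq {c c' : Cmd} (h : Correct P x c) (h' : Correct P x c') :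
    Correct P x (c.seq c') := by
  intro o d r s hc hr
  simp only [compile, codeAt_append, length_compile] at hc
  obtain ⟨r1, h1, hr1, hk1⟩ := h hc.1 hr
  obtain ⟨r2, h2, hr2, hk2⟩ := h' hc.2 hr1
  exact ⟨r2, (h1.trans h2).cast rfl (by simp only [len]; omega), hr2, hk1.trans hk2⟩

theorem Correct.ite {c c' : Cmd} (e : Expr) (h : Correct P x c) (h' : Correct P x c') :
    Correct P x (ite e c c') := by
  intro o d r s hc hr
  simp only [compile, codeAt_append, codeAt_cons, length_compile, Expr.length_compile,
    List.length_cons, List.length_nil, zero_add] at hc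
  obtain ⟨hc1, ⟨hc2, -⟩, hc3, ⟨hc4, -⟩, hc5⟩ := hc
  obtain ⟨r1, h1, hr1, hk1, hv1⟩ := e.runs_compile (x := x) hc1 hr
  have h2 := Runs.instr (x := x) hc2 r1
  simp only [Instr.exec, hv1] at h2
  change Runs P x 1 _ r1 (if e.Holds x s then _ else _) r1 at h2
  by_cases he : e.Holds x s
  · rw [if_pos he] at h2
    obtain ⟨r2, h3, hr2, hk2⟩ := h hc5 hr1
    refine ⟨r2, ((h1.trans h2).trans h3).cast ?_ ?_, ?_, hk1.trans hk2⟩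
    · simp only [cost, if_pos he]
    · simp only [len]; omega
    · simpa only [eval, if_pos he] using hr2
  · rw [if_neg he] at h2
    obtain ⟨r2, h3, hr2, hk2⟩ := h' hc3 hr1
    refine ⟨r2, (((h1.trans h2).trans h3).trans (Runs.instr hc4 r2)).cast ?_ ?_, ?_,
      hk1.trans hk2⟩
    · simp only [cost, if_neg he]; omega
    · simp only [len, Instr.exec]; omega
    · simpa only [eval, if_neg he] using hr2

theorem Correct.runs_round {c : Cmd} (h : Correct P x c) {i z o d n j : ℕ} {r : ℕ → ℕ} {s : St}
    (hc : CodeAt P o ((loop i z c).compile d o)) (hr : Rep r s) (hn : r (tmp d) = n)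
    (hj : r (tmp (d + 1)) = j) (hjn : j < n) :
    ∃ r', Runs P x (6 + c.cost x (s.setV i j)) (o + 2) r (o + 2) r' ∧
      Rep r' (c.eval x (s.setV i j)) ∧ Keep d r r' ∧ r' (tmp d) = n ∧
      r' (tmp (d + 1)) = j + 1 := by
  simp only [compile, codeAt_append, codeAt_cons, length_compile,
    List.length_cons, List.length_nil, zero_add] at hc
  obtain ⟨⟨-, -, hc3, hc4, hc5, -⟩, hc6, hc7, hc8, hc9, -⟩ := hc
  have hd1 : tmp d ≠ tmp (d + 1) := by simp [tmp]
  have hd2 : tmp d ≠ tmp (d + 2) := by simp [tmp]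
  have hd3 : tmp (d + 1) ≠ tmp (d + 2) := by simp [tmp]
  have hdi : ∀ j, tmp j ≠ vreg i := fun j => by simp only [tmp, vreg]; omega
  have h3 := Runs.instr (x := x) hc3 r
  simp only [Instr.exec, Cfg.write, hn, hj] at h3
  have h4 := Runs.instr (x := x) hc4 (Function.update r (tmp (d + 2)) (n - j))
  simp only [Instr.exec, Function.update_self, if_neg (Nat.sub_ne_zero_of_lt hjn)] at h4
  have h5 := Runs.instr (x := x) hc5 (Function.update r (tmp (d + 2)) (n - j))
  simp only [Instr.exec, Cfg.write, Function.update_of_ne hd3, hj] at h5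
  obtain ⟨r', h6, hr', hk⟩ := h hc6 ((hr.update_tmp (d + 2) (n - j)).update_vreg i j)
  have hn' := hk d (by omega)
  have hj' := hk (d + 1) (by omega)
  rw [Function.update_of_ne (hdi _), Function.update_of_ne hd2, hn] at hn'
  rw [Function.update_of_ne (hdi _), Function.update_of_ne hd3, hj] at hj'
  refine ⟨_, ((((((h3.trans h4).trans h5).trans h6).trans (Runs.instr hc7 _)).trans
    (Runs.instr hc8 _)).trans (Runs.instr hc9 _)).cast (by omega) rfl,
    (hr'.update_tmp _ _).update_tmp _ _, ?_, ?_, ?_⟩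
  · exact (((((Keep.refl d r).update_tmp (by omega) _).update_vreg _ _).trans
      (hk.mono (by omega))).update_tmp (by omega) _).update_tmp (by omega) _
  · simp only [Instr.exec, Cfg.write, Function.update_of_ne hd1, Function.update_of_ne hd2, hn']
  · simp only [Instr.exec, Cfg.write, Function.update_self, Function.update_of_ne hd3, hj']

theorem Correct.runs_rounds {c : Cmd} (h : Correct P x c) {i z o d : ℕ} {r : ℕ → ℕ} {s : St}
    (hc : CodeAt P o ((loop i z c).compile d o)) (hr : Rep r s) {j : ℕ} (hj : j ≤ s.v z) :
    ∃ r', Runs P x (2 + ∑ j ∈ Finset.range j,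
        (6 + c.cost x ((s.rounds (c.eval x) i j).setV i j))) o r (o + 2) r' ∧
      Rep r' (s.rounds (c.eval x) i j) ∧ Keep d r r' ∧ r' (tmp d) = s.v z ∧
      r' (tmp (d + 1)) = j := by
  induction j with
  | zero =>
    simp only [compile, List.cons_append, codeAt_cons] at hc
    have hd : tmp d ≠ tmp (d + 1) := by simp [tmp]
    refine ⟨_, ((Runs.instr hc.1 r).trans (Runs.instr hc.2.1 _)).cast rfl rfl,
      (hr.update_tmp _ _).update_tmp _ _,
      ((Keep.refl d r).update_tmp le_rfl _).update_tmp (Nat.le_succ d) _, ?_, ?_⟩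
    · simp only [Instr.exec, Cfg.write, Function.update_self, Function.update_of_ne hd, hr.1]
    · simp only [Instr.exec, Cfg.write, Function.update_self]
  | succ j ih =>
    obtain ⟨r1, h1, hr1, hk1, hn1, hj1⟩ := ih (by omega)
    obtain ⟨r2, h2, hr2, hk2, hn2, hj2⟩ := h.runs_round hc hr1 hn1 hj1 (by omega)
    exact ⟨r2, (h1.trans h2).cast (by rw [Finset.sum_range_succ]; omega) rfl, hr2,
      hk1.trans hk2, hn2, hj2⟩

theorem Correct.loop {c : Cmd} (i z : ℕ) (h : Correct P x c) : Correct P x (loop i z c) := by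
  intro o d r s hc hr
  obtain ⟨r', h1, hr', hk, hn, hj⟩ := h.runs_rounds hc hr le_rfl
  simp only [compile, List.cons_append, codeAt_cons] at hc
  obtain ⟨-, -, hc3, hc4, -⟩ := hc
  have h3 := Runs.instr (x := x) hc3 r'
  simp only [Instr.exec, Cfg.write, hn, hj] at h3
  have h4 := Runs.instr (x := x) hc4 (Function.update r' (tmp (d + 2)) (s.v z - s.v z))
  simp only [Instr.exec, Function.update_self, if_pos (Nat.sub_self (s.v z))] at h4
  exact ⟨_, ((h1.trans h3).trans h4).cast (by simp only [cost]; omega) (by simp only [len]),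
    hr'.update_tmp _ _, hk.update_tmp (by omega) _⟩

theorem correct (c : Cmd) : Correct P x c := by
  induction c with
  | skip => exact fun _ hr => ⟨_, Runs.refl _ _, hr, Keep.refl _ _⟩
  | set i e => exact correct_set i e
  | put k e f => exact correct_put k e f
  | seq c c' h h' => exact h.seq h'
  | ite e c c' h h' => exact h.ite e h'
  | loop i z c h => exact h.loop i z

theorem outputsWithin_compile (c : Cmd) (x : List ℕ) {T b : ℕ}
    (hT : c.cost x .start ≤ T) (hb : (c.eval x .start).v 0 = b) :
    OutputsWithin (c.compile 0 0) x b T := by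
  obtain ⟨r, h, hr, -⟩ := c.correct (P := c.compile 0 0) (x := x) (r := fun _ => 0)
    (o := 0) (d := 0) (s := .start) List.prefix_rfl ⟨fun _ => rfl, fun _ _ => rfl⟩
  have h' : run (c.compile 0 0) x (c.cost x .start) = ⟨0 + c.len, r⟩ := h
  refine ⟨_, hT, ?_, ?_⟩
  · rw [h', length_compile, zero_add]
  · rw [h', ← hb]; exact hr.1 0

end Cmd

end Correctness

/-! #### Running times and frames -/

namespace Cmd

/-- The variables that a command may write to. -/
def writtenVars : Cmd → List ℕ
  | skip => []
  | set i _ => [i]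
  | put _ _ _ => []
  | seq c c' => c.writtenVars ++ c'.writtenVars
  | ite _ c c' => c.writtenVars ++ c'.writtenVars
  | loop i _ c => i :: c.writtenVars

/-- The arrays that a command may write to. -/
def writtenArrs : Cmd → List (Fin 8)
  | skip => []
  | set _ _ => []
  | put k _ _ => [k]
  | seq c c' => c.writtenArrs ++ c'.writtenArrs
  | ite _ c c' => c.writtenArrs ++ c'.writtenArrs
  | loop _ _ c => c.writtenArrs

/-- The variables that bound the loops of a command. -/
def loopBounds : Cmd → List ℕ
  | skip => []
  | set _ _ => []
  | put _ _ _ => []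
  | seq c c' => c.loopBounds ++ c'.loopBounds
  | ite _ c c' => c.loopBounds ++ c'.loopBounds
  | loop _ z c => z :: c.loopBounds

/-- A bound on the cost of a command all of whose loops make at most `M` rounds. -/
def time (M : ℕ) : Cmd → ℕ
  | skip => 0
  | set _ e => e.size + 1
  | put _ e f => e.size + f.size + 7
  | seq c c' => c.time M + c'.time M
  | ite e c c' => e.size + 2 + (c.time M + c'.time M)
  | loop _ _ c => 4 + M * (6 + c.time M)

end Cmd

theorem St.rounds_preserves {α : Type*} {p : St → α} {f : St → St} {i : ℕ}
    (hf : ∀ s, p (f s) = p s) (hi : ∀ s n, p (s.setV i n) = p s) (s : St) (n : ℕ) :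
    p (s.rounds f i n) = p s := by
  induction n with
  | zero => rfl
  | succ n ih => rw [rounds, hf, hi, ih]

namespace Cmd

theorem eval_preserves {α : Type*} {p : St → α} (x : List ℕ) (c : Cmd) (s : St)
    (hv : ∀ i ∈ c.writtenVars, ∀ s n, p (s.setV i n) = p s)
    (ha : ∀ k ∈ c.writtenArrs, ∀ s i n, p (s.setA k i n) = p s) :
    p (c.eval x s) = p s := by
  induction c generalizing s with
  | skip => rfl
  | set i e => exact hv i (by simp [writtenVars]) _ _
  | put k e f => exact ha k (by simp [writtenArrs]) _ _ _
  | seq c c' hc hc' =>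
    simp only [writtenVars, writtenArrs, List.forall_mem_append] at hv ha
    rw [eval, hc' _ hv.2 ha.2, hc _ hv.1 ha.1]
  | ite e c c' hc hc' =>
    simp only [writtenVars, writtenArrs, List.forall_mem_append] at hv ha
    rw [eval]
    split_ifs
    exacts [hc _ hv.1 ha.1, hc' _ hv.2 ha.2]
  | loop i z c hc =>
    simp only [writtenVars, List.forall_mem_cons] at hv
    exact St.rounds_preserves (fun s => hc s hv.2 ha) hv.1 _ _

theorem eval_v_of_notMem (x : List ℕ) (c : Cmd) (s : St) {i : ℕ} (h : i ∉ c.writtenVars) :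
    (c.eval x s).v i = s.v i :=
  c.eval_preserves (p := fun s => s.v i) x s
    (fun _ hj _ _ => St.setV_v_of_ne _ _ fun hij => h (hij ▸ hj)) fun _ _ _ _ _ => rfl

theorem eval_a_of_notMem (x : List ℕ) (c : Cmd) (s : St) {k : Fin 8} (h : k ∉ c.writtenArrs) :
    (c.eval x s).a k = s.a k :=
  c.eval_preserves (p := fun s => s.a k) x s (fun _ _ _ _ => rfl)
    fun _ hl _ _ _ => St.setA_a_of_ne _ _ _ fun hkl => h (hkl ▸ hl)

theorem cost_le_time (x : List ℕ) {M : ℕ} (c : Cmd) (s : St)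
    (hw : ∀ z ∈ c.loopBounds, z ∉ c.writtenVars) (hs : ∀ z ∈ c.loopBounds, s.v z ≤ M) :
    c.cost x s ≤ c.time M := by
  suffices h : ∀ c' : Cmd, c'.loopBounds ⊆ c.loopBounds → c'.writtenVars ⊆ c.writtenVars →
      ∀ s' : St, (∀ z ∈ c.loopBounds, s'.v z = s.v z) → c'.cost x s' ≤ c'.time M from
    h c (List.Subset.refl _) (List.Subset.refl _) s fun _ _ => rfl
  intro c' hb hv
  induction c' with
  | skip | set | put => exact fun _ _ => le_rfl
  | seq c₁ c₂ h₁ h₂ =>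
    simp only [loopBounds, writtenVars, List.append_subset] at hb hv
    exact fun s' hs' => add_le_add (h₁ hb.1 hv.1 s' hs') (h₂ hb.2 hv.2 _ fun z hz =>
      (c₁.eval_v_of_notMem x s' fun h => hw z hz (hv.1 h)).trans (hs' z hz))
  | ite e c₁ c₂ h₁ h₂ =>
    simp only [loopBounds, writtenVars, List.append_subset] at hb hv
    intro s' hs'
    have := h₁ hb.1 hv.1 s' hs'
    have := h₂ hb.2 hv.2 s' hs'
    simp only [cost, time]
    split_ifs <;> omega
  | loop i z c₁ h₁ =>
    simp only [loopBounds, writtenVars, List.cons_subset] at hb hv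
    intro s' hs'
    have body (j : ℕ) : c₁.cost x ((s'.rounds (c₁.eval x) i j).setV i j) ≤ c₁.time M := by
      refine h₁ hb.2 hv.2 _ fun y hy => ?_
      have hyi : y ≠ i := fun h => hw y hy (h ▸ hv.1)
      have hyc : y ∉ c₁.writtenVars := fun h => hw y hy (hv.2 h)
      rw [St.setV_v_of_ne _ _ hyi, St.rounds_preserves (p := fun s => s.v y)
        (fun s => c₁.eval_v_of_notMem x s hyc) (fun s _ => s.setV_v_of_ne _ hyi), hs' y hy]
    calc (loop i z c₁).cost x s' ≤ 4 + ∑ _j ∈ Finset.range (s'.v z), (6 + c₁.time M) :=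
          Nat.add_le_add_left (Finset.sum_le_sum fun j _ => Nat.add_le_add_left (body j) 6) 4
      _ = 4 + s.v z * (6 + c₁.time M) := by simp [hs' z hb.1]
      _ ≤ (loop i z c₁).time M := Nat.add_le_add_left (Nat.mul_le_mul_right _ (hs z hb.1)) 4

theorem exists_time_le (c : Cmd) : ∃ C D : ℕ, ∀ M, c.time M ≤ C * (M + 1) ^ D := by
  have weaken {C D D' M t : ℕ} (h : t ≤ C * (M + 1) ^ D) (hD : D ≤ D') : t ≤ C * (M + 1) ^ D' :=
    h.trans (Nat.mul_le_mul_left _ (Nat.pow_le_pow_right (Nat.succ_pos _) hD))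
  induction c with
  | skip | set | put => exact ⟨_, 0, fun M => by rw [pow_zero, mul_one]; exact le_rfl⟩
  | seq c c' hc hc' =>
    obtain ⟨C, D, h⟩ := hc
    obtain ⟨C', D', h'⟩ := hc'
    refine ⟨C + C', D + D', fun M => ?_⟩
    rw [add_mul]
    exact add_le_add (weaken (h M) (by omega)) (weaken (h' M) (by omega))
  | ite e c c' hc hc' =>
    obtain ⟨C, D, h⟩ := hc
    obtain ⟨C', D', h'⟩ := hc'
    refine ⟨e.size + 2 + (C + C'), D + D', fun M => ?_⟩
    rw [add_mul, add_mul C]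
    exact add_le_add (Nat.le_mul_of_pos_right _ (by positivity))
      (add_le_add (weaken (h M) (by omega)) (weaken (h' M) (by omega)))
  | loop i z c hc =>
    obtain ⟨C, D, h⟩ := hc
    refine ⟨4 + (6 + C), D + 1, fun M => ?_⟩
    have hpow : 1 ≤ (M + 1) ^ D := Nat.one_le_pow _ _ (Nat.succ_pos _)
    calc (loop i z c).time M ≤ 4 + (M + 1) * (6 + C * (M + 1) ^ D) :=
          Nat.add_le_add_left (Nat.mul_le_mul (Nat.le_succ M) (Nat.add_le_add_left (h M) 6)) 4
      _ ≤ (4 + (6 + C)) * (M + 1) ^ (D + 1) := by rw [pow_succ]; nlinarith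

/-! #### Rules for loops -/

theorem inv_loop (x : List ℕ) {i z : ℕ} {c : Cmd} {s : St} {R : ℕ → St → Prop} (h0 : R 0 s)
    (hs : ∀ (j : ℕ) (s' : St), j < s.v z → R j s' → R (j + 1) (c.eval x (s'.setV i j))) :
    R (s.v z) ((loop i z c).eval x s) := by
  suffices h : ∀ n ≤ s.v z, R n (s.rounds (c.eval x) i n) from h _ le_rfl
  intro n hn
  induction n with
  | zero => exact h0
  | succ n ih => exact hs n _ hn (ih (Nat.le_of_succ_le hn))

theorem rel_loop {α : Type*} (x : List ℕ) {i z : ℕ} {c : Cmd} {s : St} {n : ℕ}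
    {R : St → α → Prop} {f : α → Fin n → α} {a : α} (hz : s.v z = n) (h0 : R s a)
    (hs : ∀ (s : St) (a : α) (j : Fin n), R s a → R (c.eval x (s.setV i j)) (f a j)) :
    R ((loop i z c).eval x s) ((List.finRange n).foldl f a) := by
  suffices h : ∀ l ≤ n, R (s.rounds (c.eval x) i l) (((List.finRange n).take l).foldl f a) by
    simpa only [eval, hz, List.take_of_length_le (List.length_finRange (n := n)).le]
      using h n le_rfl
  intro l hl
  induction l with
  | zero => exact h0
  | succ l ih =>
    rw [List.take_add_one, List.foldl_append,
      List.getElem?_eq_getElem (by simpa using hl), List.getElem_finRange]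
    exact hs _ _ ⟨l, hl⟩ (ih (Nat.le_of_succ_le hl))

theorem rel_loop_loop {α : Type*} (x : List ℕ) {i i' z : ℕ} {c : Cmd} {s : St} {n : ℕ}
    {R : St → α → Prop} {f : α → α} {a : α} (hz : ∀ s a, R s a → s.v z = n)
    (hi : ∀ s a j, R s a → R (s.setV i j) a) (hi' : ∀ s a j, R s a → R (s.setV i' j) a)
    (hc : ∀ s a, 0 < n → R s a → R (c.eval x s) (f a)) (h0 : R s a) :
    R ((loop i z (loop i' z c)).eval x s) (f^[n * n] a) := by
  have inner (s : St) (a : α) (h : R s a) : R ((loop i' z c).eval x s) (f^[n] a) := by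
    simpa only [List.foldl_const, List.length_finRange] using
      rel_loop x (f := fun a (_ : Fin n) => f a) (hz s a h) h
        fun s a j h => hc _ _ j.pos (hi' s a j h)
  simpa only [List.foldl_const, List.length_finRange, ← Function.iterate_mul] using
    rel_loop x (f := fun a (_ : Fin n) => f^[n] a) (hz s a h0) h0
      fun s a j h => inner _ _ (hi s a j h)

theorem v_eval_loop_and_eq_zero (x : List ℕ) {i z b : ℕ} {e : Expr} (s : St) {F : ℕ → Prop}
    (hbi : b ≠ i) (he : ∀ s' : St, (∀ j, j ≠ b → j ≠ i → s'.v j = s.v j) → s'.a = s.a →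
      s'.v i < s.v z → (e.Holds x s' ↔ F (s'.v i))) :
    ((loop i z (set b ((Expr.var b).and e))).eval x s).v b = 0 ↔
      s.v b = 0 ∧ ∀ j < s.v z, F j := by
  refine (inv_loop x (i := i) (z := z) (c := set b ((Expr.var b).and e)) (s := s)
    (R := fun l s' => (∀ j, j ≠ b → j ≠ i → s'.v j = s.v j) ∧ s'.a = s.a ∧
      (s'.v b = 0 ↔ s.v b = 0 ∧ ∀ j < l, F j))
    ⟨fun _ _ _ => rfl, rfl, by simp⟩ ?_).2.2
  rintro l s' hl ⟨hv, ha, hb⟩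
  have hv' (j) (hjb : j ≠ b) (hji : j ≠ i) : (s'.setV i l).v j = s.v j := by
    rw [St.setV_v_of_ne _ _ hji, hv j hjb hji]
  refine ⟨fun j hjb hji => ?_, ha, ?_⟩
  · rw [eval, St.setV_v_of_ne _ _ hjb, hv' j hjb hji]
  · have : ((Expr.var b).and e).Holds x (s'.setV i l) ↔ s'.v b = 0 ∧ F l := by
      rw [Expr.holds_and, he _ hv' ha (by rwa [St.setV_v_self]), St.setV_v_self, Expr.Holds,
        Expr.eval, St.setV_v_of_ne _ _ hbi]
    rw [eval, St.setV_v_self, Nat.forall_lt_succ_right, ← and_assoc, ← hb]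
    exact this

end Cmd

end LoopLang

/-! ### Extreme points of transportation polytopes -/

namespace Transportation

open Finset Topology

theorem exists_mem_extremePoints_forall_le {E : Type*} [AddCommGroup E] [Module ℝ E]
    [TopologicalSpace E] [T2Space E] [IsTopologicalAddGroup E] [ContinuousSMul ℝ E]
    [LocallyConvexSpace ℝ E] {F : Set E} (hF : IsCompact F) (hne : F.Nonempty) (l : E →L[ℝ] ℝ) :
    ∃ y ∈ F.extremePoints ℝ, ∀ z ∈ F, l z ≤ l y := by
  obtain ⟨w, hw, hmax⟩ := hF.exists_isMaxOn hne l.continuous.continuousOn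
  have hface : IsExposed ℝ F (l.toExposed F) := ContinuousLinearMap.toExposed.isExposed
  obtain ⟨y, hy⟩ := (hface.isCompact hF).extremePoints_nonempty ⟨w, hw, fun z hz => hmax hz⟩
  exact ⟨y, hface.isExtreme.extremePoints_subset_extremePoints hy, hy.1.2⟩

theorem eq_zero_of_eventually_add_smul_mem {E : Type*} [AddCommGroup E] [Module ℝ E] {F : Set E}
    {y d : E} (hy : y ∈ F.extremePoints ℝ) (hd : ∀ᶠ t : ℝ in 𝓝 0, y + t • d ∈ F) : d = 0 := by
  obtain ⟨ε, hε, hball⟩ := Metric.eventually_nhds_iff.1 hd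
  have hpos : y + (ε / 2) • d ∈ F := hball (by rw [Real.dist_eq, sub_zero, abs_of_pos] <;> linarith)
  have hneg : y + (-(ε / 2)) • d ∈ F :=
    hball (by rw [Real.dist_eq, sub_zero, abs_neg, abs_of_pos] <;> linarith)
  have hmid : y ∈ openSegment ℝ (y + (ε / 2) • d) (y + (-(ε / 2)) • d) :=
    ⟨1 / 2, 1 / 2, by norm_num, by norm_num, by norm_num, by module⟩
  have := hy.2 hpos hneg hmid
  simpa [hε.ne'] using this

theorem eventually_add_mul_le {a b e : ℝ} (hab : a ≤ b) (htight : a = b → e = 0) :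
    ∀ᶠ t : ℝ in 𝓝 0, a + t * e ≤ b := by
  rcases hab.eq_or_lt with rfl | hlt
  · simp [htight rfl]
  · have : Filter.Tendsto (fun t : ℝ => a + t * e) (𝓝 0) (𝓝 a) := by
      simpa using (show Continuous fun t : ℝ => a + t * e by fun_prop).tendsto 0
    filter_upwards [this.eventually_lt_const hlt] with t ht using ht.le

theorem exists_ne_zero_forall_sum_eq_zero {α τ : Type*} [Fintype τ] (S : Finset α)
    (l : τ → Finset α) (h : Fintype.card τ < #S) :
    ∃ d : α → ℝ, d ≠ 0 ∧ (∀ p ∉ S, d p = 0) ∧ ∀ k, ∑ p ∈ l k, d p = 0 := by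
  let extend := Function.ExtendByZero.linearMap ℝ (Subtype.val : S → α)
  let f : (S → ℝ) →ₗ[ℝ] (τ → ℝ) :=
    LinearMap.pi fun k => (∑ p ∈ l k, LinearMap.proj p) ∘ₗ extend
  obtain ⟨y, hy, hy0⟩ := (Submodule.ne_bot_iff _).1
    (LinearMap.ker_ne_bot_of_finrank_lt (f := f) (by simpa using h))
  refine ⟨extend y, fun h0 => hy0 ?_, fun p hp => ?_, fun k => ?_⟩
  · exact funext fun p =>
      (Subtype.val_injective.extend_apply y 0 p).symm.trans (congrFun h0 p)
  · exact Function.extend_apply' _ _ _ fun ⟨q, hq⟩ => hp (hq ▸ q.2)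
  · simpa [f] using congrFun (LinearMap.mem_ker.1 hy) k

theorem two_le_card_fiber_of_sum_eq {α β : Type*} [DecidableEq β] {S : Finset α} {f : α → β}
    {x : α → ℝ} {b : β → ℝ} (hx : ∀ p ∈ S, x p ≠ b (f p)) {i : β} (hi : i ∈ S.image f)
    (hsum : ∑ p ∈ S with f p = i, x p = b i) : 2 ≤ #{p ∈ S | f p = i} := by
  obtain ⟨p, hp, rfl⟩ := mem_image.1 hi
  have hpf : p ∈ {q ∈ S | f q = f p} := mem_filter.2 ⟨hp, rfl⟩
  by_contra! hlt
  obtain ⟨q, hq⟩ := card_eq_one.1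
    (Nat.le_antisymm (Nat.le_of_lt_succ hlt) (card_pos.2 ⟨p, hpf⟩))
  obtain rfl : p = q := by simpa [hq] using hpf
  exact hx p hp (by rwa [hq, sum_singleton] at hsum)

theorem card_add_card_image_le {α β : Type*} [DecidableEq β] {S : Finset α} {f : α → β}
    {A : Finset β} (hA : A ⊆ S.image f) (h : ∀ i ∈ A, 2 ≤ #{p ∈ S | f p = i}) :
    #A + #(S.image f) ≤ #S := by
  calc #A + #(S.image f) = ∑ i ∈ S.image f, ((if i ∈ A then 1 else 0) + 1) := by
        rw [sum_add_distrib, sum_boole, filter_mem_eq_inter, inter_eq_right.2 hA]; simp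
    _ ≤ ∑ i ∈ S.image f, #{p ∈ S | f p = i} := sum_le_sum fun i hi => by
        split_ifs with hiA
        · exact h i hiA
        · obtain ⟨p, hp, hpi⟩ := mem_image.1 hi
          exact card_pos.2 ⟨p, mem_filter.2 ⟨hp, hpi⟩⟩
    _ = #S := (card_eq_sum_card_image f S).symm

variable {ι κ : Type*} [DecidableEq ι] [DecidableEq κ]

/-- The assignments of nonnegative numbers to the cells in `S` whose row and column sums respect the
bounds `r` and `c`. Only the rows and columns that meet `S` are bounded. -/
def polytope (S : Finset (ι × κ)) (r : ι → ℝ) (c : κ → ℝ) : Set (ι × κ → ℝ) :=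
  {x | (∀ p, 0 ≤ x p) ∧ (∀ p ∉ S, x p = 0) ∧
    (∀ p ∈ S, ∑ q ∈ S with q.1 = p.1, x q ≤ r p.1) ∧
    ∀ p ∈ S, ∑ q ∈ S with q.2 = p.2, x q ≤ c p.2}

variable {S : Finset (ι × κ)} {r : ι → ℝ} {c : κ → ℝ} {x : ι × κ → ℝ}

theorem le_row_of_mem_polytope (hx : x ∈ polytope S r c) {p : ι × κ} (hp : p ∈ S) :
    x p ≤ r p.1 :=
  (single_le_sum (f := x) (fun q _ => hx.1 q)
    (mem_filter.2 ⟨hp, rfl⟩ : p ∈ {q ∈ S | q.1 = p.1})).trans (hx.2.2.1 p hp)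

theorem le_col_of_mem_polytope (hx : x ∈ polytope S r c) {p : ι × κ} (hp : p ∈ S) :
    x p ≤ c p.2 :=
  (single_le_sum (f := x) (fun q _ => hx.1 q)
    (mem_filter.2 ⟨hp, rfl⟩ : p ∈ {q ∈ S | q.2 = p.2})).trans (hx.2.2.2 p hp)

theorem isCompact_polytope (S : Finset (ι × κ)) (r : ι → ℝ) (c : κ → ℝ) :
    IsCompact (polytope S r c) := by
  have hclosed : IsClosed (polytope S r c) := by
    simp only [polytope, Set.ofPred_and, Set.ofPred_forall]
    refine .inter (isClosed_iInter fun p => ?_) (.inter (isClosed_biInter fun p _ => ?_)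
      (.inter (isClosed_biInter fun p _ => ?_) (isClosed_biInter fun p _ => ?_)))
    · exact isClosed_le continuous_const (continuous_apply p)
    · exact isClosed_eq (continuous_apply p) continuous_const
    · exact isClosed_le (continuous_finsetSum _ fun q _ => continuous_apply q) continuous_const
    · exact isClosed_le (continuous_finsetSum _ fun q _ => continuous_apply q) continuous_const
  refine (isCompact_univ_pi (s := fun p => Set.Icc 0 (if p ∈ S then r p.1 else 0))
    fun p => isCompact_Icc).of_isClosed_subset hclosed fun x hx p _ => ?_
  by_cases hp : p ∈ S
  · simpa [hp] using ⟨hx.1 p, le_row_of_mem_polytope hx hp⟩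
  · simp [hp, hx.2.1 p hp]

theorem eventually_add_smul_mem_polytope (hx : x ∈ polytope S r c) {d : ι × κ → ℝ}
    (hd : ∀ p, x p = 0 → d p = 0)
    (hrow : ∀ p ∈ S, ∑ q ∈ S with q.1 = p.1, x q = r p.1 → ∑ q ∈ S with q.1 = p.1, d q = 0)
    (hcol : ∀ p ∈ S, ∑ q ∈ S with q.2 = p.2, x q = c p.2 → ∑ q ∈ S with q.2 = p.2, d q = 0) :
    ∀ᶠ t : ℝ in 𝓝 0, x + t • d ∈ polytope S r c := by
  have hsum (T : Finset (ι × κ)) (t : ℝ) :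
      ∑ q ∈ T, (x + t • d) q = ∑ q ∈ T, x q + t * ∑ q ∈ T, d q := by
    simp [sum_add_distrib, mul_sum]
  have hnonneg : ∀ᶠ t : ℝ in 𝓝 0, ∀ p ∈ S, -x p + t * -d p ≤ 0 :=
    (Filter.eventually_all_finset S).2 fun p _ => eventually_add_mul_le
      (neg_nonpos.2 (hx.1 p)) fun h => by rw [hd p (neg_eq_zero.1 h), neg_zero]
  have hrows : ∀ᶠ t : ℝ in 𝓝 0, ∀ p ∈ S, ∑ q ∈ S with q.1 = p.1, (x + t • d) q ≤ r p.1 := by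
    simp only [hsum]
    exact (Filter.eventually_all_finset S).2 fun p hp =>
      eventually_add_mul_le (hx.2.2.1 p hp) (hrow p hp)
  have hcols : ∀ᶠ t : ℝ in 𝓝 0, ∀ p ∈ S, ∑ q ∈ S with q.2 = p.2, (x + t • d) q ≤ c p.2 := by
    simp only [hsum]
    exact (Filter.eventually_all_finset S).2 fun p hp =>
      eventually_add_mul_le (hx.2.2.2 p hp) (hcol p hp)
  have hoff (t : ℝ) (p) (hp : p ∉ S) : (x + t • d) p = 0 := by
    simp [hx.2.1 p hp, hd p (hx.2.1 p hp)]
  filter_upwards [hnonneg, hrows, hcols] with t hn hr hc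
  refine ⟨fun p => ?_, hoff t, hr, hc⟩
  by_cases hp : p ∈ S
  · have := hn p hp
    simp only [Pi.add_apply, Pi.smul_apply, smul_eq_mul]
    linarith
  · exact (hoff t p hp).ge

theorem exists_ne_zero_forall_row_col_sum_eq_zero {A : Finset ι} {B : Finset κ}
    (h : #A + #B < #S) :
    ∃ d : ι × κ → ℝ, d ≠ 0 ∧ (∀ p ∉ S, d p = 0) ∧ (∀ i ∈ A, ∑ q ∈ S with q.1 = i, d q = 0) ∧
      ∀ j ∈ B, ∑ q ∈ S with q.2 = j, d q = 0 := by
  simpa using exists_ne_zero_forall_sum_eq_zero S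
    (Sum.elim (fun i : A => {q ∈ S | q.1 = i}) fun j : B => {q ∈ S | q.2 = j}) (by simpa using h)

/-- One of the row and column equations follows from the others, since the total is both the sum
over the rows and the sum over the columns. -/
theorem exists_ne_zero_forall_row_col_sum_eq_zero_of_card_le (hS : S.Nonempty)
    (h : #(S.image Prod.fst) + #(S.image Prod.snd) ≤ #S) :
    ∃ d : ι × κ → ℝ, d ≠ 0 ∧ (∀ p ∉ S, d p = 0) ∧
      (∀ i ∈ S.image Prod.fst, ∑ q ∈ S with q.1 = i, d q = 0) ∧
      ∀ j ∈ S.image Prod.snd, ∑ q ∈ S with q.2 = j, d q = 0 := by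
  obtain ⟨p, hp⟩ := hS
  have hi : p.1 ∈ S.image Prod.fst := mem_image_of_mem _ hp
  obtain ⟨d, hd0, hdS, hrow, hcol⟩ := exists_ne_zero_forall_row_col_sum_eq_zero
    (S := S) (A := (S.image Prod.fst).erase p.1) (B := S.image Prod.snd)
    (by have := card_erase_lt_of_mem hi; omega)
  refine ⟨d, hd0, hdS, fun i hmem => ?_, hcol⟩
  have htotal : ∑ q ∈ S, d q = 0 := by
    rw [← sum_fiberwise_of_maps_to (g := Prod.snd) fun q hq => mem_image_of_mem _ hq]
    exact sum_eq_zero hcol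
  rw [← sum_fiberwise_of_maps_to (g := Prod.fst) fun q hq => mem_image_of_mem _ hq,
    ← add_sum_erase _ _ hi, sum_eq_zero hrow, add_zero] at htotal
  by_cases hip : i = p.1
  · rwa [hip]
  · exact hrow i (mem_erase.2 ⟨hip, hmem⟩)

/-- Every tight row and column has at least two cells, so there are at most `#S` of them, and if
there are `#S` then all rows and columns are tight. -/
theorem exists_ne_zero_tight_direction (hS : S.Nonempty) (hr : ∀ p ∈ S, x p ≠ r p.1)
    (hc : ∀ p ∈ S, x p ≠ c p.2) :
    ∃ d : ι × κ → ℝ, d ≠ 0 ∧ (∀ p ∉ S, d p = 0) ∧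
      (∀ p ∈ S, ∑ q ∈ S with q.1 = p.1, x q = r p.1 → ∑ q ∈ S with q.1 = p.1, d q = 0) ∧
      ∀ p ∈ S, ∑ q ∈ S with q.2 = p.2, x q = c p.2 → ∑ q ∈ S with q.2 = p.2, d q = 0 := by
  set R := S.image Prod.fst
  set C := S.image Prod.snd
  set A := {i ∈ R | ∑ q ∈ S with q.1 = i, x q = r i}
  set B := {j ∈ C | ∑ q ∈ S with q.2 = j, x q = c j}
  have hAR : A ⊆ R := filter_subset _ _
  have hBC : B ⊆ C := filter_subset _ _
  have hcardA : #A + #R ≤ #S := card_add_card_image_le hAR fun i hi =>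
    two_le_card_fiber_of_sum_eq hr (mem_filter.1 hi).1 (mem_filter.1 hi).2
  have hcardB : #B + #C ≤ #S := card_add_card_image_le hBC fun j hj =>
    two_le_card_fiber_of_sum_eq hc (mem_filter.1 hj).1 (mem_filter.1 hj).2
  have hcardAR := card_le_card hAR
  have hcardBC := card_le_card hBC
  obtain ⟨d, hd0, hdS, hrow, hcol⟩ : ∃ d : ι × κ → ℝ, d ≠ 0 ∧ (∀ p ∉ S, d p = 0) ∧
      (∀ i ∈ A, ∑ q ∈ S with q.1 = i, d q = 0) ∧ ∀ j ∈ B, ∑ q ∈ S with q.2 = j, d q = 0 := by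
    rcases lt_or_ge (#A + #B) #S with hlt | hge
    · exact exists_ne_zero_forall_row_col_sum_eq_zero hlt
    · rw [eq_of_subset_of_card_le hAR (by omega), eq_of_subset_of_card_le hBC (by omega)]
      exact exists_ne_zero_forall_row_col_sum_eq_zero_of_card_le hS
        (show #R + #C ≤ #S by omega)
  exact ⟨d, hd0, hdS, fun p hp h => hrow _ (mem_filter.2 ⟨mem_image_of_mem _ hp, h⟩),
    fun p hp h => hcol _ (mem_filter.2 ⟨mem_image_of_mem _ hp, h⟩)⟩

theorem exists_eq_zero_or_eq_min_of_mem_extremePoints (hS : S.Nonempty)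
    (hx : x ∈ (polytope S r c).extremePoints ℝ) :
    ∃ p ∈ S, x p = 0 ∨ x p = min (r p.1) (c p.2) := by
  by_contra! hne
  have hrow := fun p hp => le_row_of_mem_polytope hx.1 (p := p) hp
  have hcol := fun p hp => le_col_of_mem_polytope hx.1 (p := p) hp
  obtain ⟨d, hd0, hdS, hdrow, hdcol⟩ := exists_ne_zero_tight_direction (r := r) (c := c) (x := x) hS
    (fun p hp h => (hne p hp).2 (by rw [← h, min_eq_left (hcol p hp)]))
    (fun p hp h => (hne p hp).2 (by rw [← h, min_eq_right (hrow p hp)]))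
  exact hd0 (eq_zero_of_eventually_add_smul_mem hx (eventually_add_smul_mem_polytope hx.1
    (fun p hp => hdS p fun hpS => (hne p hpS).1 hp) hdrow hdcol))

theorem exists_sum_le_and_eq_zero_or_eq_min (hS : S.Nonempty) (hx : x ∈ polytope S r c) :
    ∃ y ∈ polytope S r c, ∑ p ∈ S, x p ≤ ∑ p ∈ S, y p ∧
      ∃ p ∈ S, y p = 0 ∨ y p = min (r p.1) (c p.2) := by
  obtain ⟨y, hy, hmax⟩ := exists_mem_extremePoints_forall_le (isCompact_polytope S r c) ⟨x, hx⟩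
    (∑ p ∈ S, ContinuousLinearMap.proj p)
  exact ⟨y, hy.1, by simpa using hmax x hx,
    exists_eq_zero_or_eq_min_of_mem_extremePoints hS hy⟩

theorem sum_filter_erase_update (hx : ∀ p ∉ S, x p = 0) (t : ι × κ) (P : ι × κ → Prop)
    [DecidablePred P] : ∑ q ∈ S.erase t with P q, Function.update x t 0 q =
      ∑ q ∈ S with P q, x q - if P t then x t else 0 := by
  rw [filter_erase, sum_congr rfl fun q hq => Function.update_of_ne (ne_of_mem_erase hq) _ _]
  by_cases ht : t ∈ {q ∈ S | P q}
  · rw [sum_erase_eq_sub ht, if_pos (mem_filter.1 ht).2]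
  · have h0 : (if P t then x t else 0) = 0 := by
      rw [ite_eq_right_iff]
      exact fun h => hx t fun htS => ht (mem_filter.2 ⟨htS, h⟩)
    rw [erase_eq_of_notMem ht, h0, sub_zero]

theorem update_mem_polytope_erase (hx : x ∈ polytope S r c) (t : ι × κ) :
    Function.update x t 0 ∈
      polytope (S.erase t) (r - Pi.single t.1 (x t)) (c - Pi.single t.2 (x t)) := by
  refine ⟨fun p => ?_, fun p hp => ?_, fun p hp => ?_, fun p hp => ?_⟩
  · rcases eq_or_ne p t with rfl | h
    · simp
    · simpa [h] using hx.1 p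
  · rcases eq_or_ne p t with rfl | h
    · simp
    · simpa [h] using hx.2.1 p fun hpS => hp (mem_erase.2 ⟨h, hpS⟩)
  · rw [sum_filter_erase_update hx.2.1, Pi.sub_apply, Pi.single_apply]
    simpa only [eq_comm] using sub_le_sub_right (hx.2.2.1 p (mem_of_mem_erase hp)) _
  · rw [sum_filter_erase_update hx.2.1, Pi.sub_apply, Pi.single_apply]
    simpa only [eq_comm] using sub_le_sub_right (hx.2.2.2 p (mem_of_mem_erase hp)) _

end Transportation

/-! ### Greedy common induced subgraphs -/

namespace Greedy

open Finset Transportation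

variable {V W ι κ : Type*}
variable (G : SimpleGraph V) (H : SimpleGraph W) (c : V → ι) (d : W → κ)

/-- Two pairs of vertices can occur together in an isomorphism between induced subgraphs. -/
def Compat (p q : V × W) : Prop :=
  p.1 ≠ q.1 ∧ p.2 ≠ q.2 ∧ (G.Adj p.1 q.1 ↔ H.Adj p.2 q.2)

instance : Std.Symm (Compat G H) where
  symm _ _ h := ⟨h.1.symm, h.2.1.symm, by rw [G.adj_comm, H.adj_comm]; exact h.2.2⟩

/-- The isomorphisms between induced subgraphs, as lists of pairs of vertices. -/
def Valid (L : List (V × W)) : Prop := L.Pairwise (Compat G H)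

/-- The pair of classes to which a pair of vertices belongs. -/
def cls (q : V × W) : ι × κ := (c q.1, d q.2)

open Classical in
/-- Append `q` if it belongs to the classes `t` and is compatible with the pairs present. -/
noncomputable def tryAdd (t : ι × κ) (L : List (V × W)) (q : V × W) : List (V × W) :=
  if cls c d q = t ∧ ∀ p ∈ L, Compat G H p q then L ++ [q] else L

/-- Append as many pairs from the classes `t` as possible, where `us` and `vs` list the vertices of
the two graphs. -/
noncomputable def phase (us : List V) (vs : List W) (L : List (V × W)) (t : ι × κ) :
    List (V × W) :=
  us.foldl (fun L u => vs.foldl (fun L v => tryAdd G H c d t L (u, v)) L) L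

/-- `Q` extends `L` by pairs from the classes `t`, and no other such pair can be added. -/
structure IsMaximalExt (t : ι × κ) (L Q : List (V × W)) : Prop where
  cls_eq : ∀ q ∈ Q, cls c d q = t
  valid : Valid G H (L ++ Q)
  exists_not_compat : ∀ q, cls c d q = t → ∃ p ∈ L ++ Q, ¬ Compat G H p q

/-- Some two pairs of vertices from the classes `t` are incompatible: one of the two classes is a
clique and the other one is independent. -/
def Mixed (t : ι × κ) : Prop :=
  ∃ p q : V × W, cls c d p = t ∧ cls c d q = t ∧ p.1 ≠ q.1 ∧ p.2 ≠ q.2 ∧ ¬ Compat G H p q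

theorem foldl_tryAdd (t : ι × κ) (l L : List (V × W)) :
    ∃ Q, l.foldl (tryAdd G H c d t) L = L ++ Q ∧ (∀ q ∈ Q, cls c d q = t) ∧
      (Valid G H L → Valid G H (L ++ Q)) ∧
      ∀ q ∈ l, cls c d q = t → ∃ p ∈ L ++ Q, ¬ Compat G H p q := by
  induction l generalizing L with
  | nil => exact ⟨[], by simp⟩
  | cons a l ih =>
    rw [List.foldl_cons, tryAdd]
    split_ifs with h
    · obtain ⟨Q, hfold, hcls, hvalid, hmax⟩ := ih (L ++ [a])
      rw [← List.append_cons] at hfold hvalid hmax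
      refine ⟨a :: Q, hfold, List.forall_mem_cons.2 ⟨h.1, hcls⟩, fun hL => hvalid ?_,
        List.forall_mem_cons.2 ⟨fun _ => ⟨a, by simp, fun h => h.1 rfl⟩, hmax⟩⟩
      exact List.pairwise_append.2 ⟨hL, List.pairwise_singleton _ _, by simpa using h.2⟩
    · obtain ⟨Q, hfold, hcls, hvalid, hmax⟩ := ih L
      refine ⟨Q, hfold, hcls, hvalid, List.forall_mem_cons.2 ⟨fun ha => ?_, hmax⟩⟩
      obtain ⟨p, hp, hpa⟩ : ∃ p ∈ L, ¬ Compat G H p a := by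
        by_contra! hcompat
        exact h ⟨ha, hcompat⟩
      exact ⟨p, List.mem_append_left _ hp, hpa⟩

theorem phase_eq_foldl_product (us : List V) (vs : List W) (L : List (V × W)) (t : ι × κ) :
    phase G H c d us vs L t = (us.product vs).foldl (tryAdd G H c d t) L := by
  simp only [phase, List.product, List.foldl_flatMap, List.foldl_map]

theorem length_le_phase (us : List V) (vs : List W) (L : List (V × W)) (t : ι × κ) :
    L.length ≤ (phase G H c d us vs L t).length := by
  obtain ⟨Q, h, -⟩ := foldl_tryAdd G H c d t (us.product vs) L
  simp [phase_eq_foldl_product, h]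

variable {G H}

theorem Valid.phase {L : List (V × W)} (hL : Valid G H L) (us : List V) (vs : List W)
    (t : ι × κ) : Valid G H (phase G H c d us vs L t) := by
  obtain ⟨Q, h, -, hvalid, -⟩ := foldl_tryAdd G H c d t (us.product vs) L
  rw [phase_eq_foldl_product, h]
  exact hvalid hL

theorem Valid.exists_phase_eq_append {L : List (V × W)} (hL : Valid G H L) {us : List V}
    {vs : List W} (hus : ∀ u, u ∈ us) (hvs : ∀ v, v ∈ vs) (t : ι × κ) :
    ∃ Q, Greedy.phase G H c d us vs L t = L ++ Q ∧ IsMaximalExt G H c d t L Q := by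
  obtain ⟨Q, h, hcls, hvalid, hmax⟩ := foldl_tryAdd G H c d t (us.product vs) L
  exact ⟨Q, (phase_eq_foldl_product G H c d us vs L t).trans h, hcls, hvalid hL,
    fun q => hmax q (List.mem_product.2 ⟨hus _, hvs _⟩)⟩

theorem Valid.nodup_fst {L : List (V × W)} (h : Valid G H L) : (L.map Prod.fst).Nodup :=
  List.pairwise_map.2 (h.imp fun h => h.1)

theorem Valid.nodup_snd {L : List (V × W)} (h : Valid G H L) : (L.map Prod.snd).Nodup :=
  List.pairwise_map.2 (h.imp fun h => h.2.1)

variable {c d}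

theorem adj_congr_of_twins (hc : ∀ u u', c u = c u' → G.Twins u u') {u u' a a' : V}
    (hu : u ≠ u') (ha : a ≠ a') (h : c u = c a) (h' : c u' = c a') :
    G.Adj u u' ↔ G.Adj a a' := by
  by_cases hua : u' = a
  · subst hua
    by_cases hua' : u = a'
    · subst hua'; exact G.adj_comm _ _
    · rw [(G.twins_iff u a').1 (hc _ _ (h.trans h')) u' hu.symm ha, G.adj_comm]
  · rw [(G.twins_iff u a).1 (hc _ _ h) u' hu.symm hua, G.adj_comm,
      (G.twins_iff u' a').1 (hc _ _ h') a (Ne.symm hua) ha, G.adj_comm]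

theorem Compat.congr_cls (hc : ∀ u u', c u = c u' → G.Twins u u')
    (hd : ∀ v v', d v = d v' → H.Twins v v') {p q p' q' : V × W} (h : Compat G H p q)
    (h1 : p'.1 ≠ q'.1) (h2 : p'.2 ≠ q'.2) (hp : cls c d p' = cls c d p)
    (hq : cls c d q' = cls c d q) : Compat G H p' q' := by
  simp only [cls, Prod.mk.injEq] at hp hq
  refine ⟨h1, h2, ?_⟩
  rw [adj_congr_of_twins hc h1 h.1 hp.1 hq.1, adj_congr_of_twins hd h2 h.2.1 hp.2 hq.2]
  exact h.2.2

theorem Valid.length_le_one_of_mixed (hc : ∀ u u', c u = c u' → G.Twins u u')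
    (hd : ∀ v v', d v = d v' → H.Twins v v') {Q : List (V × W)} {t : ι × κ} (hQ : Valid G H Q)
    (hcls : ∀ q ∈ Q, cls c d q = t) (ht : Mixed G H c d t) : Q.length ≤ 1 := by
  match Q, hQ, hcls with
  | [], _, _ | [_], _, _ => simp
  | a :: b :: Q, hQ, hcls =>
    obtain ⟨p, q, hp, hq, h1, h2, hpq⟩ := ht
    have hab : Compat G H a b := List.rel_of_pairwise_cons hQ (by simp)
    exact absurd (hab.congr_cls hc hd h1 h2 (hp.trans (hcls a (by simp)).symm)
      (hq.trans (hcls b (by simp)).symm)) hpq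

section Residual

variable {U : Type*} [Fintype U] [DecidableEq ι] (e : U → ι)

/-- The number of vertices of class `i` that do not occur in the list `l`. -/
noncomputable def residual (l : List U) (i : ι) : ℝ :=
  (#{u | e u = i} : ℝ) - l.countP (e · = i)

theorem residual_nonneg {l : List U} (hl : l.Nodup) (i : ι) : 0 ≤ residual e l i := by
  classical
  rw [residual, sub_nonneg, Nat.cast_le, List.countP_eq_length_filter,
    ← List.toFinset_card_of_nodup (hl.filter _)]
  exact card_le_card fun u hu => by simpa using (List.mem_filter.1 (List.mem_toFinset.1 hu)).2

theorem countP_le_residual_nil {l : List U} (hl : l.Nodup) (i : ι) :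
    (l.countP (e · = i) : ℝ) ≤ residual e [] i := by
  simpa [residual] using residual_nonneg e hl i

theorem residual_append {l' : List U} {a : ι} (h : ∀ u ∈ l', e u = a) (l : List U) :
    residual e (l ++ l') = residual e l - Pi.single a (l'.length : ℝ) := by
  have hcount (i : ι) : l'.countP (e · = i) = if i = a then l'.length else 0 := by
    split_ifs with hi
    · exact List.countP_eq_length.2 fun u hu => by simp [h u hu, hi]
    · exact List.countP_eq_zero.2 fun u hu => by simp [h u hu, Ne.symm hi]
  ext i
  rw [Pi.sub_apply, Pi.single_apply, residual, residual, List.countP_append, hcount]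
  split_ifs <;> push_cast <;> ring

variable {e}

theorem exists_notMem_of_residual_pos {l : List U} {i : ι} (h : 0 < residual e l i) :
    ∃ u, e u = i ∧ u ∉ l := by
  classical
  by_contra! hmem
  rw [residual, sub_pos, Nat.cast_lt, List.countP_eq_length_filter] at h
  refine absurd h (not_lt.2 ((card_le_card fun u hu => ?_).trans (List.toFinset_card_le _)))
  have hu : e u = i := by simpa using hu
  exact List.mem_toFinset.2 (List.mem_filter.2 ⟨hmem u hu, by simpa using hu⟩)

end Residual

variable [DecidableEq ι] [DecidableEq κ]

variable (G H c d) in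
/-- The pairs in `L` and the unused pairs with classes in `S` are compatible, except inside mixed
pairs of classes. This is the invariant of the greedy algorithm. -/
structure Good (L : List (V × W)) (S : Finset (ι × κ)) : Prop where
  valid : Valid G H L
  compat_left : ∀ p ∈ L, ∀ q, cls c d q ∈ S → q.1 ∉ L.map Prod.fst → q.2 ∉ L.map Prod.snd →
    Compat G H p q
  compat_right : ∀ p q, cls c d p ∈ S → cls c d q ∈ S → cls c d p ≠ cls c d q → p.1 ≠ q.1 →
    p.2 ≠ q.2 → Compat G H p q

theorem Good.append {L Q : List (V × W)} {S : Finset (ι × κ)} {t : ι × κ} (h : Good G H c d L S)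
    (ht : t ∈ S) (hQ : ∀ q ∈ Q, cls c d q = t) (hv : Valid G H (L ++ Q)) :
    Good G H c d (L ++ Q) (S.erase t) := by
  refine ⟨hv, fun p hp q hq h1 h2 => ?_, fun p q hp hq =>
    h.compat_right p q (mem_of_mem_erase hp) (mem_of_mem_erase hq)⟩
  simp only [List.map_append, List.mem_append, not_or] at h1 h2
  rcases List.mem_append.1 hp with hp | hp
  · exact h.compat_left p hp q (mem_of_mem_erase hq) h1.1 h2.1
  · refine h.compat_right p q (by rwa [hQ p hp]) (mem_of_mem_erase hq) ?_ ?_ ?_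
    · rw [hQ p hp]; exact (ne_of_mem_erase hq).symm
    · exact fun he => h1.2 (he ▸ List.mem_map_of_mem hp)
    · exact fun he => h2.2 (he ▸ List.mem_map_of_mem hp)

theorem Valid.good_nil (hc : ∀ u u', c u = c u' → G.Twins u u')
    (hd : ∀ v v', d v = d v' → H.Twins v v') {M : List (V × W)} (hM : Valid G H M) :
    Good G H c d [] (M.map (cls c d)).toFinset := by
  refine ⟨List.Pairwise.nil, by simp, fun p q hp hq hpq h1 h2 => ?_⟩
  obtain ⟨p', hp', hpp⟩ := List.mem_map.1 (List.mem_toFinset.1 hp)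
  obtain ⟨q', hq', hqq⟩ := List.mem_map.1 (List.mem_toFinset.1 hq)
  have hne : p' ≠ q' := by
    rintro rfl
    exact hpq (hpp.symm.trans hqq)
  exact (hM.forall hp' hq' hne).congr_cls hc hd h1 h2 hpp.symm hqq.symm

section Exchange

variable [Fintype V] [Fintype W] {L Q : List (V × W)} {S : Finset (ι × κ)} {t : ι × κ}

theorem IsMaximalExt.exists_not_compat_of_residual_pos (h : IsMaximalExt G H c d t L Q)
    (hc : 0 < residual c ((L ++ Q).map Prod.fst) t.1)
    (hd : 0 < residual d ((L ++ Q).map Prod.snd) t.2) :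
    ∃ q, cls c d q = t ∧ q.1 ∉ (L ++ Q).map Prod.fst ∧ q.2 ∉ (L ++ Q).map Prod.snd ∧
      ∃ p ∈ L ++ Q, ¬ Compat G H p q := by
  obtain ⟨u, hu, huL⟩ := exists_notMem_of_residual_pos hc
  obtain ⟨v, hv, hvL⟩ := exists_notMem_of_residual_pos hd
  have ht : cls c d (u, v) = t := Prod.ext hu hv
  exact ⟨(u, v), ht, huL, hvL, h.exists_not_compat _ ht⟩

theorem IsMaximalExt.length_of_not_mixed (h : IsMaximalExt G H c d t L Q)
    (hgood : Good G H c d L S) (ht : t ∈ S) (hm : ¬ Mixed G H c d t) :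
    (Q.length : ℝ) = min (residual c (L.map Prod.fst) t.1) (residual d (L.map Prod.snd) t.2) := by
  have hrow := residual_nonneg c h.valid.nodup_fst t.1
  have hcol := residual_nonneg d h.valid.nodup_snd t.2
  have hexhausted : residual c ((L ++ Q).map Prod.fst) t.1 = 0 ∨
      residual d ((L ++ Q).map Prod.snd) t.2 = 0 := by
    by_contra! hne
    obtain ⟨q, hq, hq1, hq2, p, hp, hpq⟩ := h.exists_not_compat_of_residual_pos
      (hrow.lt_of_ne' hne.1) (hcol.lt_of_ne' hne.2)
    rw [List.map_append, List.mem_append, not_or] at hq1 hq2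
    rcases List.mem_append.1 hp with hp | hp
    · exact hpq (hgood.compat_left p hp q (hq ▸ ht) hq1.1 hq2.1)
    · exact hm ⟨p, q, h.cls_eq p hp, hq, fun he => hq1.2 (he ▸ List.mem_map_of_mem hp),
        fun he => hq2.2 (he ▸ List.mem_map_of_mem hp), hpq⟩
  have hfst : ∀ u ∈ Q.map Prod.fst, c u = t.1 :=
    List.forall_mem_map.2 fun q hq => congrArg Prod.fst (h.cls_eq q hq)
  have hsnd : ∀ v ∈ Q.map Prod.snd, d v = t.2 :=
    List.forall_mem_map.2 fun q hq => congrArg Prod.snd (h.cls_eq q hq)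
  rw [List.map_append, residual_append c hfst, Pi.sub_apply, Pi.single_eq_same,
    List.length_map] at hrow hexhausted
  rw [List.map_append, residual_append d hsnd, Pi.sub_apply, Pi.single_eq_same,
    List.length_map] at hcol hexhausted
  rcases hexhausted with h0 | h0
  · rw [min_eq_left] <;> linarith
  · rw [min_eq_right] <;> linarith

theorem IsMaximalExt.length_of_mixed (hc : ∀ u u', c u = c u' → G.Twins u u')
    (hd : ∀ v v', d v = d v' → H.Twins v v') (h : IsMaximalExt G H c d t L Q)
    (hgood : Good G H c d L S) (ht : t ∈ S) (hm : Mixed G H c d t)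
    (hrow : 0 < residual c (L.map Prod.fst) t.1) (hcol : 0 < residual d (L.map Prod.snd) t.2) :
    Q.length = 1 := by
  have hQ : Valid G H Q := (List.pairwise_append.1 h.valid).2.1
  refine (hQ.length_le_one_of_mixed hc hd h.cls_eq hm).antisymm (List.length_pos_iff.2 ?_)
  rintro rfl
  obtain ⟨q, hq, hq1, hq2, p, hp, hpq⟩ := h.exists_not_compat_of_residual_pos
    (by rwa [List.append_nil]) (by rwa [List.append_nil])
  rw [List.append_nil] at hp hq1 hq2
  exact hpq (hgood.compat_left p hp q (hq ▸ ht) hq1 hq2)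

theorem update_mem_polytope_append {x : ι × κ → ℝ}
    (hx : x ∈ polytope S (residual c (L.map Prod.fst)) (residual d (L.map Prod.snd)))
    (hQ : ∀ q ∈ Q, cls c d q = t) (hlen : (Q.length : ℝ) = x t) :
    Function.update x t 0 ∈ polytope (S.erase t) (residual c ((L ++ Q).map Prod.fst))
      (residual d ((L ++ Q).map Prod.snd)) := by
  have hfst : ∀ u ∈ Q.map Prod.fst, c u = t.1 :=
    List.forall_mem_map.2 fun q hq => congrArg Prod.fst (hQ q hq)
  have hsnd : ∀ v ∈ Q.map Prod.snd, d v = t.2 :=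
    List.forall_mem_map.2 fun q hq => congrArg Prod.snd (hQ q hq)
  rw [List.map_append, List.map_append, residual_append c hfst, residual_append d hsnd,
    List.length_map, List.length_map, hlen]
  exact update_mem_polytope_erase hx t

theorem Good.exists_exchange (hc : ∀ u u', c u = c u' → G.Twins u u')
    (hd : ∀ v v', d v = d v' → H.Twins v v') {us : List V} {vs : List W} (hus : ∀ u, u ∈ us)
    (hvs : ∀ v, v ∈ vs) {x : ι × κ → ℝ} (h : Good G H c d L S) (hS : S.Nonempty)
    (hx : x ∈ polytope S (residual c (L.map Prod.fst)) (residual d (L.map Prod.snd)))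
    (hm : ∀ t ∈ S, Mixed G H c d t → x t = 1) :
    ∃ y ∈ polytope S (residual c (L.map Prod.fst)) (residual d (L.map Prod.snd)),
      ∑ t ∈ S, x t ≤ ∑ t ∈ S, y t ∧ (∀ t ∈ S, Mixed G H c d t → y t = 1) ∧
      ∃ t ∈ S, ∃ Q, (Q = [] ∨ phase G H c d us vs L t = L ++ Q) ∧ (∀ q ∈ Q, cls c d q = t) ∧
        Valid G H (L ++ Q) ∧ (Q.length : ℝ) = y t := by
  by_cases hmixed : ∃ t ∈ S, Mixed G H c d t
  · obtain ⟨t, ht, hmt⟩ := hmixed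
    obtain ⟨Q, hphase, hQ⟩ := h.valid.exists_phase_eq_append c d hus hvs t
    have hlen : Q.length = 1 := hQ.length_of_mixed hc hd h ht hmt
      (by linarith [le_row_of_mem_polytope hx ht, hm t ht hmt])
      (by linarith [le_col_of_mem_polytope hx ht, hm t ht hmt])
    exact ⟨x, hx, le_rfl, hm, t, ht, Q, .inr hphase, hQ.cls_eq, hQ.valid, by
      rw [hlen, hm t ht hmt, Nat.cast_one]⟩
  · push Not at hmixed
    obtain ⟨y, hy, hxy, t, ht, hyt⟩ := exists_sum_le_and_eq_zero_or_eq_min hS hx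
    refine ⟨y, hy, hxy, fun s hs hms => absurd hms (hmixed s hs), t, ht, ?_⟩
    rcases hyt with hyt | hyt
    · exact ⟨[], .inl rfl, by simp, by simpa using h.valid, by simp [hyt]⟩
    · obtain ⟨Q, hphase, hQ⟩ := h.valid.exists_phase_eq_append c d hus hvs t
      exact ⟨Q, .inr hphase, hQ.cls_eq, hQ.valid,
        (hQ.length_of_not_mixed h ht (hmixed t ht)).trans hyt.symm⟩

theorem Good.exists_phases (hc : ∀ u u', c u = c u' → G.Twins u u')
    (hd : ∀ v v', d v = d v' → H.Twins v v') {us : List V} {vs : List W} (hus : ∀ u, u ∈ us)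
    (hvs : ∀ v, v ∈ vs) {x : ι × κ → ℝ} (h : Good G H c d L S)
    (hx : x ∈ polytope S (residual c (L.map Prod.fst)) (residual d (L.map Prod.snd)))
    (hm : ∀ t ∈ S, Mixed G H c d t → x t = 1) :
    ∃ l : List (ι × κ), (∀ t ∈ l, t ∈ S) ∧ l.length ≤ #S ∧
      (L.length : ℝ) + ∑ t ∈ S, x t ≤ (l.foldl (phase G H c d us vs) L).length := by
  induction hn : #S generalizing S L x with
  | zero =>
    rw [card_eq_zero] at hn
    subst hn
    exact ⟨[], by simp⟩
  | succ n ih =>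
    obtain ⟨y, hy, hxy, hmy, t, ht, Q, hphase, hQ, hvalid, hlen⟩ :=
      h.exists_exchange hc hd hus hvs (card_pos.1 (by omega)) hx hm
    have hsum : ∑ s ∈ S.erase t, Function.update y t 0 s = ∑ s ∈ S, y s - y t := by
      rw [← sum_erase_eq_sub ht]
      exact sum_congr rfl fun s hs => Function.update_of_ne (ne_of_mem_erase hs) _ _
    obtain ⟨l, hl, hcard, hfold⟩ := ih (h.append ht hQ hvalid)
      (update_mem_polytope_append hy hQ hlen)
      (fun s hs hms => by
        rw [Function.update_of_ne (ne_of_mem_erase hs)]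
        exact hmy s (mem_of_mem_erase hs) hms)
      (by rw [card_erase_of_mem ht, hn, Nat.add_sub_cancel])
    have hlS : ∀ s ∈ l, s ∈ S := fun s hs => mem_of_mem_erase (hl s hs)
    rw [List.length_append, Nat.cast_add, hsum] at hfold
    rcases hphase with rfl | hphase
    · rw [List.append_nil] at hfold
      exact ⟨l, hlS, by omega, by linarith⟩
    · refine ⟨t :: l, List.forall_mem_cons.2 ⟨ht, hlS⟩, by rw [List.length_cons]; omega, ?_⟩
      rw [List.foldl_cons, hphase]
      linarith

theorem sum_filter_countP_eq {α β : Type*} [DecidableEq β] (f : α → β) (M : List α) (P : β → Prop)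
    [DecidablePred P] :
    ∑ b ∈ (M.map f).toFinset with P b, M.countP (f · = b) = M.countP (P <| f ·) := by
  simpa only [List.count, List.countP_map, Function.comp_def, beq_eq_decide]
    using sum_filter_count_eq_countP P (M.map f)

theorem Valid.countP_mem_polytope {M : List (V × W)} (hM : Valid G H M) :
    (fun t => (M.countP (cls c d · = t) : ℝ)) ∈
      polytope (M.map (cls c d)).toFinset (residual c []) (residual d []) := by
  refine ⟨fun t => Nat.cast_nonneg _, fun t ht => ?_, fun t _ => ?_, fun t _ => ?_⟩
  · simpa using ht
  · rw [← Nat.cast_sum, sum_filter_countP_eq]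
    have hle := countP_le_residual_nil c hM.nodup_fst t.1
    rw [List.countP_map] at hle
    exact hle
  · rw [← Nat.cast_sum, sum_filter_countP_eq]
    have hle := countP_le_residual_nil d hM.nodup_snd t.2
    rw [List.countP_map] at hle
    exact hle

end Exchange

theorem Valid.countP_eq_one_of_mixed (hc : ∀ u u', c u = c u' → G.Twins u u')
    (hd : ∀ v v', d v = d v' → H.Twins v v') {M : List (V × W)} (hM : Valid G H M) {t : ι × κ}
    (ht : t ∈ M.map (cls c d)) (hm : Mixed G H c d t) : M.countP (cls c d · = t) = 1 := by
  refine le_antisymm ?_ (List.countP_pos_iff.2 (by simpa using ht))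
  rw [List.countP_eq_length_filter]
  exact Valid.length_le_one_of_mixed hc hd (hM.filter _) (by simp) hm

omit [DecidableEq ι] [DecidableEq κ] in
theorem Valid.exists_phases [Finite V] [Finite W] (hc : ∀ u u', c u = c u' → G.Twins u u')
    (hd : ∀ v v', d v = d v' → H.Twins v v') {us : List V} {vs : List W} (hus : ∀ u, u ∈ us)
    (hvs : ∀ v, v ∈ vs) {I : Finset ι} {J : Finset κ} (hI : ∀ u, c u ∈ I) (hJ : ∀ v, d v ∈ J)
    {M : List (V × W)} (hM : Valid G H M) :
    ∃ l : List (ι × κ), (∀ t ∈ l, t ∈ I ×ˢ J) ∧ l.length ≤ #I * #J ∧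
      M.length ≤ (l.foldl (Greedy.phase G H c d us vs) []).length := by
  classical
  have := Fintype.ofFinite V
  have := Fintype.ofFinite W
  have hsub : (M.map (cls c d)).toFinset ⊆ I ×ˢ J := fun t ht => by
    obtain ⟨p, -, rfl⟩ := List.mem_map.1 (List.mem_toFinset.1 ht)
    exact mem_product.2 ⟨hI _, hJ _⟩
  obtain ⟨l, hl, hcard, hfold⟩ := (hM.good_nil hc hd).exists_phases hc hd hus hvs
    hM.countP_mem_polytope fun t ht hm => by
      rw [hM.countP_eq_one_of_mixed hc hd (List.mem_toFinset.1 ht) hm, Nat.cast_one]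
  refine ⟨l, fun t ht => hsub (hl t ht), card_product I J ▸ hcard.trans (card_le_card hsub), ?_⟩
  have hsum := sum_filter_countP_eq (cls c d) M fun _ => True
  rw [filter_true_of_mem fun _ _ => trivial] at hsum
  rw [← Nat.cast_sum, hsum] at hfold
  simpa using hfold

end Greedy

/-! ### The program -/

namespace MCIS

open LoopLang LoopLang.Expr LoopLang.Cmd

/-! The variables and arrays. Those with an argument exist for both graphs, `false` being the first
and `true` the second. The array `aRow b` says where the rows of a matrix start in the input, and
the variables `vOk` and `vFound` hold conditions, which are true if they are `0`. -/

abbrev vRes : ℕ := 0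
abbrev vN (b : Bool) : ℕ := cond b 2 1
abbrev vRow : ℕ := 3
abbrev vNum (b : Bool) : ℕ := cond b 5 4
abbrev vBase : ℕ := 6
abbrev vBound : ℕ := 7
abbrev vProd : ℕ := 8
abbrev vU : ℕ := 9
abbrev vV : ℕ := 10
abbrev vT : ℕ := 11
abbrev vOk : ℕ := 12
abbrev vFound : ℕ := 13
abbrev vGuess : ℕ := 14
abbrev vQuot : ℕ := 15
abbrev vI : ℕ := 16
abbrev vJ : ℕ := 17
abbrev vLen : ℕ := 18
abbrev vTrial : ℕ := 19
abbrev vOuter : ℕ := 20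
abbrev vInner : ℕ := 21
abbrev aRow (b : Bool) : Fin 8 := cond b 1 0
abbrev aCls (b : Bool) : Fin 8 := cond b 3 2
abbrev aFst : Fin 8 := 4
abbrev aSnd : Fin 8 := 5

/-- Reading the numbers of vertices; the first matrix starts at entry `3` of the input. -/
def readSizes : Cmd :=
  set (vN false) (inp (lit 0)) ;; set (vN true) (inp (lit 1)) ;; set vRow (lit 3)

/-- Finding out where the rows of an adjacency matrix start. -/
def rows (b : Bool) : Cmd :=
  loop vU (vN b) (put (aRow b) (var vU) (var vRow) ;; set vRow (var vRow + var (vN b)))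

/-- The entry of an adjacency matrix in row `e` and column `f`. -/
def bit (b : Bool) (e f : Expr) : Expr := inp (arr (aRow b) e + f)

/-- The condition that the vertex in `vT` shows that those in `vU` and `vV` are not twins. -/
def separates (b : Bool) : Expr :=
  ((var vT).eq (var vV)).not.and <| ((var vT).eq (var vU)).not.and
    ((bit b (var vV) (var vT)).eq (bit b (var vU) (var vT))).not

/-- Setting `vOk` to the condition that the vertex in `vV` is a twin of the one in `vU` and comes
before it. -/
def twinTest (b : Bool) : Cmd :=
  set vOk ((var vV).lt (var vU)) ;; loop vT (vN b) (set vOk ((var vOk).and (separates b).not))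

/-- Copying the class of the vertex in `vV` to the one in `vU` if the former is a twin of the latter
and comes before it. -/
def copyClass (b : Bool) : Cmd :=
  twinTest b ;;
    ite (var vOk) (put (aCls b) (var vU) (arr (aCls b) (var vV)) ;; set vFound (lit 0)) skip

/-- Looking for a twin of the vertex in `vU` among the vertices before it. -/
def findTwin (b : Bool) : Cmd := loop vV (vN b) (copyClass b)

/-- Finding the number of the twin class of the vertex in `vU`. -/
def classifyVertex (b : Bool) : Cmd :=
  set vFound (lit 1) ;; findTwin b ;;
    ite (var vFound) skip
      (put (aCls b) (var vU) (var (vNum b)) ;; set (vNum b) (var (vNum b) + lit 1))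

/-- Numbering the twin classes. -/
def classify (b : Bool) : Cmd := loop vU (vN b) (classifyVertex b)

/-- Finding the rows of the adjacency matrices and the twin classes. -/
def prepare : Cmd := rows false ;; rows true ;; classify false ;; classify true

/-- Choosing the base in which guesses are written. -/
def setBase : Cmd := set vBase (var (vNum false) + var (vNum true)) ;; set vBound (lit 1)

/-- Multiplying `vBound` by `vBase`. -/
def mulBase : Cmd :=
  set vProd (lit 0) ;; loop vT vBase (set vProd (var vProd + var vBound)) ;; set vBound (var vProd)

/-- Computing the number of guesses. -/
def powers : Cmd := loop vOuter vBase (loop vInner vBase (mulBase ;; mulBase))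

/-- Division with remainder of `vGuess` by `vBase`. -/
def divMod : Cmd :=
  set vQuot (lit 0) ;;
    loop vT vBound (ite ((var vGuess).lt (var vBase)) skip
      (set vGuess ((var vGuess).sub (var vBase)) ;; set vQuot (var vQuot + lit 1)))

/-- Moving the last digit of the guess to variable `d`. -/
def digit (d : ℕ) : Cmd := divMod ;; set d (var vGuess) ;; set vGuess (var vQuot)

/-- The condition that the pair of the vertices in `vU` and `vV` is compatible with the one at
position `vT` of the list, if there is one. -/
def compatible : Expr :=
  (((var vT).lt (var vLen)).and
    (((arr aFst (var vT)).eq (var vU)).not.and <| ((arr aSnd (var vT)).eq (var vV)).not.and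
      ((bit false (arr aFst (var vT)) (var vU)).eq
        (bit true (arr aSnd (var vT)) (var vV)))).not).not

/-- Appending the pair of the vertices in `vU` and `vV` to the list. -/
def append : Cmd :=
  put aFst (var vLen) (var vU) ;; put aSnd (var vLen) (var vV) ;; set vLen (var vLen + lit 1)

/-- Setting `vOk` to the condition that the pair of the vertices in `vU` and `vV` is of the right
class and compatible with the list, which is never longer than the first graph. -/
def pairTest : Cmd :=
  set vOk (((arr (aCls false) (var vU)).eq (var vI)).and
    ((arr (aCls true) (var vV)).eq (var vJ))) ;;
  loop vT (vN false) (set vOk ((var vOk).and compatible))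

/-- Appending the pair of the vertices in `vU` and `vV` if it passes the test. -/
def tryAdd : Cmd := pairTest ;; ite (var vOk) append skip

/-- Appending as many pairs from the classes in `vI` and `vJ` as possible. -/
def phase : Cmd := loop vU (vN false) (loop vV (vN true) tryAdd)

/-- Running the phases that the guess prescribes. -/
def phases : Cmd := loop vOuter vBase (loop vInner vBase (digit vI ;; digit vJ ;; phase))

/-- Trying the guess in `vTrial`. -/
def trial : Cmd :=
  set vGuess (var vTrial) ;; set vLen (lit 0) ;; phases ;;
    ite ((var vLen).lt (inp (lit 2))) skip (set vRes (lit 1))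

/-- Trying all guesses. -/
def search : Cmd := loop vTrial vBound trial

/-- The program that decides the problem. -/
def program : Cmd := readSizes ;; prepare ;; setBase ;; powers ;; search

end MCIS

/-! ### Numbering the twin classes -/

namespace MCIS

/-- The vertices in `S` belong to `k` twin classes, and `f` numbers these classes. -/
structure TwinNumbering {V : Type*} (G : SimpleGraph V) (S : Set V) (k : ℕ) (f : V → ℕ) :
    Prop where
  lt : ∀ u ∈ S, f u < k
  eq_iff : ∀ u ∈ S, ∀ w ∈ S, f u = f w ↔ G.Twins u w
  surj : ∀ i < k, ∃ u ∈ S, f u = i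

namespace TwinNumbering

variable {V : Type*} {G : SimpleGraph V} {S : Set V} {k : ℕ} {f f' : V → ℕ} {u w : V}

theorem insert_of_twins (h : TwinNumbering G S k f) (hf : S.EqOn f' f) (hw : w ∈ S)
    (ht : G.Twins w u) (hu : f' u = f w) : TwinNumbering G (insert u S) k f' := by
  have twins := G.twins_equivalence
  have rep : ∀ v ∈ insert u S, ∃ v' ∈ S, f' v = f v' ∧ G.Twins v' v := by
    rintro v (rfl | hv)
    exacts [⟨w, hw, hu, ht⟩, ⟨v, hv, hf hv, twins.refl v⟩]
  refine ⟨fun v hv => ?_, fun v₁ hv₁ v₂ hv₂ => ?_, fun i hi => ?_⟩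
  · obtain ⟨v', hv', he, -⟩ := rep v hv
    exact he ▸ h.lt v' hv'
  · obtain ⟨v₁', hv₁', he₁, ht₁⟩ := rep v₁ hv₁
    obtain ⟨v₂', hv₂', he₂, ht₂⟩ := rep v₂ hv₂
    rw [he₁, he₂, h.eq_iff v₁' hv₁' v₂' hv₂']
    exact ⟨fun ht => twins.trans (twins.symm ht₁) (twins.trans ht ht₂),
      fun ht => twins.trans ht₁ (twins.trans ht (twins.symm ht₂))⟩
  · obtain ⟨v, hv, rfl⟩ := h.surj i hi
    exact ⟨v, Set.mem_insert_of_mem u hv, hf hv⟩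

theorem insert_of_not_twins (h : TwinNumbering G S k f) (hf : S.EqOn f' f)
    (ht : ∀ w ∈ S, ¬ G.Twins w u) (hu : f' u = k) : TwinNumbering G (insert u S) (k + 1) f' := by
  have twins := G.twins_equivalence
  have lt (v) (hv : v ∈ S) : f' v < k := hf hv ▸ h.lt v hv
  refine ⟨?_, ?_, fun i hi => ?_⟩
  · rintro v (rfl | hv)
    exacts [hu.trans_lt k.lt_succ_self, (lt v hv).trans k.lt_succ_self]
  · rintro v₁ (rfl | hv₁) v₂ (rfl | hv₂)
    · exact iff_of_true rfl (twins.refl _)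
    · exact iff_of_false (hu ▸ (lt v₂ hv₂).ne') fun h => ht v₂ hv₂ (twins.symm h)
    · exact iff_of_false (hu ▸ (lt v₁ hv₁).ne) (ht v₁ hv₁)
    · rw [hf hv₁, hf hv₂, h.eq_iff v₁ hv₁ v₂ hv₂]
  · obtain hi | rfl := Nat.lt_succ_iff_lt_or_eq.1 hi
    · obtain ⟨v, hv, rfl⟩ := h.surj i hi
      exact ⟨v, Set.mem_insert_of_mem u hv, hf hv⟩
    · exact ⟨u, Set.mem_insert u S, hu⟩

theorem le_nd [Finite V] (h : TwinNumbering G S k f) : k ≤ G.nd := by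
  choose v hv hfv using fun i : Fin k => h.surj i i.2
  have inj : Function.Injective fun i => Quotient.mk G.twinSetoid (v i) := fun i j hij => by
    have hf : f (v i) = f (v j) := (h.eq_iff _ (hv i) _ (hv j)).2 (Quotient.exact hij)
    rw [hfv, hfv] at hf
    exact Fin.ext hf
  simpa only [Nat.card_eq_fintype_card, Fintype.card_fin, SimpleGraph.nd] using
    Nat.card_le_card_of_injective _ inj

end TwinNumbering

open LoopLang LoopLang.Expr LoopLang.Cmd

theorem eval_rows (x : List ℕ) (b : Bool) (s : St) :
    ((rows b).eval x s).v vRow = s.v vRow + s.v (vN b) * s.v (vN b) ∧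
      ∀ u < s.v (vN b), ((rows b).eval x s).a (aRow b) u = s.v vRow + s.v (vN b) * u := by
  refine (inv_loop x (s := s) (R := fun l s' => s'.v (vN b) = s.v (vN b) ∧
    s'.v vRow = s.v vRow + s.v (vN b) * l ∧
      ∀ u < l, s'.a (aRow b) u = s.v vRow + s.v (vN b) * u) ⟨rfl, rfl, by simp⟩ ?_).2
  rintro l s' - ⟨hn, hr, ha⟩
  have hn' : (s'.setV vU l).v (vN b) = s.v (vN b) := by cases b <;> exact hn
  refine ⟨?_, ?_, fun u hu => ?_⟩
  · rw [eval_v_of_notMem _ _ _ (by cases b <;> decide), hn']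
  · simp only [Cmd.eval, St.setV_v_self, Expr.eval, St.setA_v, hn']
    rw [St.setV_v_of_ne _ _ (by decide), hr, Nat.mul_succ, add_assoc]
  · simp only [Cmd.eval, Expr.eval, St.setV_a, St.setV_v_self, St.setA_a, true_and]
    split_ifs with hul
    · rw [St.setV_v_of_ne _ _ (by decide), hr, hul]
    · exact ha u (by omega)

open Classical in
/-- The variables and arrays of the graph `b` and the input `x` describe the graph `G`. -/
def HasGraph (x : List ℕ) (b : Bool) {n : ℕ} (G : SimpleGraph (Fin n)) (s : St) : Prop :=
  s.v (vN b) = n ∧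
    ∀ u w : Fin n, x.getD (s.a (aRow b) u + w) 0 = if G.Adj u w then 1 else 0

section

variable {x : List ℕ} {b b' : Bool} {n m : ℕ} {G : SimpleGraph (Fin n)} {H : SimpleGraph (Fin m)}
  {s s' : St}

theorem HasGraph.congr (h : HasGraph x b G s) (hv : s'.v (vN b) = s.v (vN b))
    (ha : s'.a (aRow b) = s.a (aRow b)) : HasGraph x b G s' :=
  ⟨hv.trans h.1, by rw [ha]; exact h.2⟩

theorem HasGraph.eval (h : HasGraph x b G s) (c : Cmd) (hv : vN b ∉ c.writtenVars)
    (ha : aRow b ∉ c.writtenArrs) : HasGraph x b G (c.eval x s) :=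
  h.congr (eval_v_of_notMem x c s hv) (eval_a_of_notMem x c s ha)

theorem HasGraph.holds_bit_eq_bit (hG : HasGraph x b G s) (hH : HasGraph x b' H s)
    {e f e' f' : Expr} {u w : Fin n} {u' w' : Fin m} (he : e.eval x s = u) (hf : f.eval x s = w)
    (he' : e'.eval x s = u') (hf' : f'.eval x s = w') :
    ((bit b e f).eq (bit b' e' f')).Holds x s ↔ (G.Adj u w ↔ H.Adj u' w') := by
  simp only [holds_eq, bit, Expr.eval, he, hf, he', hf', hG.2, hH.2]
  by_cases hGuw : G.Adj u w <;> by_cases hHuw : H.Adj u' w' <;> simp [hGuw, hHuw]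

theorem HasGraph.holds_separates (hG : HasGraph x b G s) {u w z : Fin n} (hu : s.v vU = u)
    (hw : s.v vV = w) (hz : s.v vT = z) :
    (separates b).Holds x s ↔ z ≠ w ∧ z ≠ u ∧ ¬ (G.Adj w z ↔ G.Adj u z) := by
  have bits := hG.holds_bit_eq_bit hG (e := var vV) (f := var vT) (e' := var vU) (f' := var vT)
    hw hz hu hz
  rw [separates, holds_and, holds_not, holds_and, holds_not, holds_not, bits, holds_eq, holds_eq]
  simp only [Expr.eval, hu, hw, hz, Fin.val_inj, ne_eq]

theorem HasGraph.eval_twinTest (hG : HasGraph x b G s) {u w : Fin n} (hu : s.v vU = u)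
    (hw : s.v vV = w) : ((twinTest b).eval x s).v vOk = 0 ↔ w < u ∧ G.Twins w u := by
  set s₁ := (set vOk ((var vV).lt (var vU))).eval x s
  have hG₁ : HasGraph x b G s₁ := hG.eval _ (by cases b <;> decide) (by cases b <;> decide)
  have hlt : s₁.v vOk = 0 ↔ w < u := by
    rw [Fin.lt_def, ← hu, ← hw]
    exact holds_lt x s (var vV) (var vU)
  have loop_iff := v_eval_loop_and_eq_zero x (i := vT) (z := vN b) (b := vOk)
    (e := (separates b).not) s₁
    (F := fun z => ∀ hz : z < n, ⟨z, hz⟩ ≠ w → ⟨z, hz⟩ ≠ u →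
      (G.Adj w ⟨z, hz⟩ ↔ G.Adj u ⟨z, hz⟩)) (by decide) fun s' hv ha hz => ?_
  · rw [twinTest, Cmd.eval, loop_iff, hlt, SimpleGraph.twins_iff, hG₁.1, Fin.forall_iff]
    exact and_congr_right fun _ => ⟨fun h z hz => h z hz hz, fun h z hz _ => h z hz⟩
  · have hG' : HasGraph x b G s' :=
      hG₁.congr (hv _ (by cases b <;> decide) (by cases b <;> decide)) (by rw [ha])
    have hu' : s'.v vU = u := (hv vU (by decide) (by decide)).trans hu
    have hw' : s'.v vV = w := (hv vV (by decide) (by decide)).trans hw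
    rw [hG₁.1] at hz
    rw [holds_not, hG'.holds_separates (z := ⟨s'.v vT, hz⟩) hu' hw' rfl]
    simp only [hz, forall_true_left]
    tauto

open Classical in
theorem HasGraph.eval_copyClass (hG : HasGraph x b G s) {u w : Fin n} (hu : s.v vU = u)
    (hw : s.v vV = w) :
    (∀ i, i ≠ (u : ℕ) → ((copyClass b).eval x s).a (aCls b) i = s.a (aCls b) i) ∧
      if w < u ∧ G.Twins w u then
        ((copyClass b).eval x s).v vFound = 0 ∧
          ((copyClass b).eval x s).a (aCls b) u = s.a (aCls b) w
      else
        ((copyClass b).eval x s).v vFound = s.v vFound ∧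
          ((copyClass b).eval x s).a (aCls b) u = s.a (aCls b) u := by
  set s₁ := (twinTest b).eval x s
  have test : s₁.v vOk = 0 ↔ w < u ∧ G.Twins w u := hG.eval_twinTest hu hw
  have ha₁ : s₁.a (aCls b) = s.a (aCls b) := eval_a_of_notMem _ _ _ (by cases b <;> decide)
  have hv₁ (i) (hi : i ∉ (twinTest b).writtenVars) : s₁.v i = s.v i := eval_v_of_notMem _ _ _ hi
  have eval_eq : (copyClass b).eval x s = if s₁.v vOk = 0 then
      (s₁.setA (aCls b) (s₁.v vU) (s₁.a (aCls b) (s₁.v vV))).setV vFound 0 else s₁ := rfl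
  rw [hv₁ vU (by cases b <;> decide), hv₁ vV (by cases b <;> decide), hu, hw, ha₁] at eval_eq
  by_cases ht : w < u ∧ G.Twins w u
  · rw [if_pos ht, eval_eq, if_pos (test.2 ht), St.setV_v_self, St.setV_a]
    simp only [St.setA_a, ha₁, true_and, if_true, and_true]
    exact fun i hi => if_neg hi
  · rw [if_neg ht, eval_eq, if_neg (mt test.1 ht), ha₁]
    exact ⟨fun _ _ => rfl, hv₁ vFound (by cases b <;> decide), rfl⟩

theorem HasGraph.eval_findTwin (hG : HasGraph x b G s) {u : Fin n} (hu : s.v vU = u)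
    (hfound : s.v vFound = 1) :
    (∀ i, i ≠ (u : ℕ) → ((findTwin b).eval x s).a (aCls b) i = s.a (aCls b) i) ∧
      if ((findTwin b).eval x s).v vFound = 0 then
        ∃ w < u, G.Twins w u ∧ ((findTwin b).eval x s).a (aCls b) u = s.a (aCls b) w
      else ∀ w < u, ¬ G.Twins w u := by
  have inv := inv_loop x (i := vV) (z := vN b) (s := s) (c := copyClass b)
    (R := fun l s' => HasGraph x b G s' ∧ s'.v vU = u ∧
      (∀ i, i ≠ (u : ℕ) → s'.a (aCls b) i = s.a (aCls b) i) ∧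
      if s'.v vFound = 0 then ∃ w < u, G.Twins w u ∧ s'.a (aCls b) u = s.a (aCls b) w
      else ∀ w < u, w < l → ¬ G.Twins w u)
    ⟨hG, hu, fun _ _ => rfl, by simp [hfound]⟩ ?_
  · obtain ⟨-, -, ha, hw⟩ := inv
    simp only [hG.1, Fin.is_lt, forall_true_left] at hw
    exact ⟨ha, hw⟩
  rintro l s' hl ⟨hG', hu', ha, hw⟩
  obtain ⟨l, rfl⟩ : ∃ w : Fin n, (w : ℕ) = l := ⟨⟨l, hG.1 ▸ hl⟩, rfl⟩
  have hG₁ : HasGraph x b G (s'.setV vV l) := hG'.congr (by cases b <;> rfl) rfl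
  obtain ⟨ha₁, hcopy⟩ := hG₁.eval_copyClass (u := u) (w := l) hu' rfl
  refine ⟨hG₁.eval _ (by cases b <;> decide) (by cases b <;> decide),
    (eval_v_of_notMem _ _ _ (by cases b <;> decide)).trans hu',
    fun i hi => (ha₁ i hi).trans (ha i hi), ?_⟩
  split_ifs at hcopy with hlu
  · rw [hcopy.1, if_pos rfl, hcopy.2]
    exact ⟨l, hlu.1, hlu.2, ha l (Fin.val_ne_of_ne hlu.1.ne)⟩
  · rw [hcopy.1, hcopy.2]
    rw [St.setV_v_of_ne _ _ (by decide), St.setV_a]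
    split_ifs at hw ⊢
    · exact hw
    · intro w hwu hwl ht
      obtain hwl | hwl := Nat.lt_succ_iff_lt_or_eq.1 hwl
      · exact hw w hwu hwl ht
      · exact hlu (Fin.ext hwl ▸ ⟨hwu, ht⟩)

/-- The graph `b` is `G`, and the twin classes of its vertices before `j` have been numbered. -/
structure Classified (x : List ℕ) (b : Bool) (G : SimpleGraph (Fin n)) (j : ℕ) (s : St) :
    Prop where
  graph : HasGraph x b G s
  numbering : TwinNumbering G {u | u < j} (s.v (vNum b)) fun u => s.a (aCls b) u

theorem Classified.eval_classifyVertex {j : ℕ} (hj : j < n) (h : Classified x b G j s) :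
    Classified x b G (j + 1) ((classifyVertex b).eval x (s.setV vU j)) := by
  set s₁ := (set vFound (lit 1)).eval x (s.setV vU j)
  have hG₁ : HasGraph x b G s₁ := h.graph.congr (by cases b <;> rfl) rfl
  obtain ⟨u, rfl⟩ : ∃ u : Fin n, (u : ℕ) = j := ⟨⟨j, hj⟩, rfl⟩
  obtain ⟨ha, hfind⟩ := hG₁.eval_findTwin (u := u) rfl rfl
  set s₂ := (findTwin b).eval x s₁
  have hu₂ : s₂.v vU = u := eval_v_of_notMem _ _ _ (by cases b <;> decide)
  have hk₂ : s₂.v (vNum b) = s.v (vNum b) :=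
    (eval_v_of_notMem _ _ _ (by cases b <;> decide)).trans (by cases b <;> rfl)
  have eval_eq : (classifyVertex b).eval x (s.setV vU u) =
      if s₂.v vFound = 0 then s₂
      else (s₂.setA (aCls b) (s₂.v vU) (s₂.v (vNum b))).setV (vNum b) (s₂.v (vNum b) + 1) := rfl
  have hS : {w : Fin n | (w : ℕ) < u + 1} = insert u {w : Fin n | (w : ℕ) < u} := by
    ext w
    simp only [Set.mem_ofPred_eq, Set.mem_insert_iff, Fin.ext_iff]
    omega
  refine ⟨(hG₁.congr (s' := (classifyVertex b).eval x (s.setV vU u)) ?_ ?_), ?_⟩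
  · exact (eval_v_of_notMem _ _ _ (by cases b <;> decide)).trans (by cases b <;> rfl)
  · exact eval_a_of_notMem _ _ _ (by cases b <;> decide)
  rw [hS, eval_eq, hu₂, hk₂]
  split_ifs at hfind ⊢ with hfound
  · obtain ⟨w, hwu, ht, hw⟩ := hfind
    rw [hk₂]
    exact h.numbering.insert_of_twins (fun w hw => ha w (ne_of_lt hw)) hwu ht hw
  · simp only [St.setV_v_self, St.setV_a, St.setA_a, true_and]
    refine h.numbering.insert_of_not_twins (fun w hw => ?_) hfind (if_pos rfl)
    exact (if_neg (ne_of_lt hw)).trans (ha w (ne_of_lt hw))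

theorem HasGraph.eval_classify (hG : HasGraph x b G s) (h0 : s.v (vNum b) = 0) :
    Classified x b G n ((classify b).eval x s) := by
  have := inv_loop x (i := vU) (R := Classified x b G) (s := s)
    ⟨hG, ⟨by simp, by simp, by simp [h0]⟩⟩
    fun j s' hj h => h.eval_classifyVertex (hG.1 ▸ hj)
  rwa [hG.1] at this

end

end MCIS

/-! ### Guesses -/

namespace MCIS

/-- Replacing `a` by `f a t`, where `t` consists of the last two digits of the first component in
base `K`, which are removed. -/
def digitStep {α : Type*} (K : ℕ) (f : α → ℕ × ℕ → α) (a : ℕ × α) : ℕ × α :=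
  (a.1 / K / K, f a.2 (a.1 % K, a.1 / K % K))

theorem exists_iterate_digitStep_eq_foldl {α : Type*} {K : ℕ} (f : α → ℕ × ℕ → α)
    (l : List (ℕ × ℕ)) (hl : ∀ t ∈ l, t.1 < K ∧ t.2 < K) :
    ∃ g < K ^ (2 * l.length), ∀ a, ((digitStep K f)^[l.length] (g, a)).2 = l.foldl f a := by
  induction l with
  | nil => exact ⟨0, by simp⟩
  | cons t l ih =>
    obtain ⟨g, hg, hgl⟩ := ih fun t ht => hl t (List.mem_cons_of_mem _ ht)
    obtain ⟨h₁, h₂⟩ := hl t List.mem_cons_self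
    have push_lt {a b B : ℕ} (ha : a < K) (hb : b < B) : a + K * b < K * B :=
      calc a + K * b < K * (b + 1) := by rw [mul_add, mul_one]; omega
        _ ≤ K * B := Nat.mul_le_mul_left K hb
    have push_div {a : ℕ} (ha : a < K) (b : ℕ) : (a + K * b) / K = b := by
      rw [Nat.add_mul_div_left _ _ (Nat.zero_lt_of_lt ha), Nat.div_eq_of_lt ha, zero_add]
    have push_mod {a : ℕ} (ha : a < K) (b : ℕ) : (a + K * b) % K = a := by
      rw [Nat.add_mul_mod_self_left, Nat.mod_eq_of_lt ha]
    refine ⟨t.1 + K * (t.2 + K * g), ?_, fun a => ?_⟩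
    · calc t.1 + K * (t.2 + K * g) < K * (K * K ^ (2 * l.length)) := push_lt h₁ (push_lt h₂ hg)
        _ = K ^ (2 * (t :: l).length) := by rw [List.length_cons]; ring
    · rw [List.length_cons, Function.iterate_succ_apply, digitStep, push_div h₁, push_div h₂,
        push_mod h₁, push_mod h₂, hgl, List.foldl_cons]

/-- The number of guesses: sequences of `K * K` pairs of digits in base `K`. -/
def guessBound (K : ℕ) : ℕ := K ^ (2 * (K * K))

theorem guessBound_mono : Monotone guessBound := fun K K' h => by
  obtain rfl | hK' := K'.eq_zero_or_pos
  · rw [Nat.le_zero.1 h]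
  · exact (Nat.pow_le_pow_left h _).trans
      (Nat.pow_le_pow_right hK' (Nat.mul_le_mul_left 2 (Nat.mul_le_mul h h)))

section

variable {n m : ℕ} (G : SimpleGraph (Fin n)) (H : SimpleGraph (Fin m)) (c : Fin n → ℕ)
  (d : Fin m → ℕ)

/-- The list of compatible pairs that the guess `g`, written in base `K`, leads to. -/
noncomputable def outcome (K g : ℕ) : List (Fin n × Fin m) :=
  ((digitStep K (Greedy.phase G H c d (List.finRange n) (List.finRange m)))^[K * K] (g, [])).2

theorem valid_outcome (K g : ℕ) : Greedy.Valid G H (outcome G H c d K g) :=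
  Function.Iterate.rec (fun a : ℕ × List (Fin n × Fin m) => Greedy.Valid G H a.2)
    (a := (g, [])) List.Pairwise.nil (fun _ ha => Greedy.Valid.phase c d ha _ _ _) _

variable {G H c d}

theorem exists_length_le_outcome (hc : ∀ u u', c u = c u' → G.Twins u u')
    (hd : ∀ v v', d v = d v' → H.Twins v v') {k k' : ℕ} (hk : ∀ u, c u < k) (hk' : ∀ v, d v < k')
    {M : List (Fin n × Fin m)} (hM : Greedy.Valid G H M) :
    ∃ g < guessBound (k + k'), M.length ≤ (outcome G H c d (k + k') g).length := by
  obtain ⟨l, hl, hlen, hlM⟩ := Greedy.Valid.exists_phases hc hd List.mem_finRange List.mem_finRange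
    (fun u => Finset.mem_range.2 (hk u)) (fun v => Finset.mem_range.2 (hk' v)) hM
  rw [Finset.card_range, Finset.card_range] at hlen
  have hlK (t) (ht : t ∈ l) : t.1 < k + k' ∧ t.2 < k + k' := by
    have := Finset.mem_product.1 (hl t ht)
    simp only [Finset.mem_range] at this
    omega
  obtain ⟨g, hg, hgl⟩ := exists_iterate_digitStep_eq_foldl
    (Greedy.phase G H c d (List.finRange n) (List.finRange m)) l hlK
  have hlen' : l.length ≤ (k + k') * (k + k') :=
    hlen.trans (Nat.mul_le_mul (Nat.le_add_right _ _) (Nat.le_add_left _ _))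
  refine ⟨g, hg.trans_le ?_, ?_⟩
  · obtain hK | hK := (k + k').eq_zero_or_pos
    · rw [hK] at hlen' ⊢
      rw [Nat.le_zero.1 hlen', guessBound]
    · exact Nat.pow_le_pow_right hK (Nat.mul_le_mul_left 2 hlen')
  · rw [outcome, ← Nat.sub_add_cancel hlen', Function.iterate_add_apply]
    refine Function.Iterate.rec (fun a : ℕ × List (Fin n × Fin m) => M.length ≤ a.2.length)
      ?_ (fun _ ha => le_trans ha (Greedy.length_le_phase G H c d _ _ _ _)) _
    rw [hgl]
    exact hlM

theorem exists_le_length_outcome_iff (hc : ∀ u u', c u = c u' → G.Twins u u')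
    (hd : ∀ v v', d v = d v' → H.Twins v v') {k k' : ℕ} (hk : ∀ u, c u < k) (hk' : ∀ v, d v < k')
    (h : ℕ) : (∃ g < guessBound (k + k'), h ≤ (outcome G H c d (k + k') g).length) ↔
      ∃ L, Greedy.Valid G H L ∧ h ≤ L.length := by
  refine ⟨fun ⟨g, _, hle⟩ => ⟨_, valid_outcome G H c d _ g, hle⟩, fun ⟨L, hL, hle⟩ => ?_⟩
  obtain ⟨g, hg, hLg⟩ := exists_length_le_outcome hc hd hk hk' hL
  exact ⟨g, hg, hle.trans hLg⟩

end

open LoopLang LoopLang.Expr LoopLang.Cmd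

theorem eval_mulBase (x : List ℕ) (s : St) :
    (mulBase.eval x s).v vBound = s.v vBound * s.v vBase := by
  refine (inv_loop x (i := vT) (z := vBase) (s := s.setV vProd 0)
    (c := set vProd (var vProd + var vBound))
    (R := fun l s' => s'.v vBound = s.v vBound ∧ s'.v vProd = s.v vBound * l) ⟨rfl, rfl⟩ ?_).2
  rintro l s' - ⟨hbound, hprod⟩
  refine ⟨hbound, ?_⟩
  rw [Nat.mul_succ, ← hprod, ← hbound]
  rfl

theorem eval_powers (x : List ℕ) {s : St} (h : s.v vBound = 1) :
    (powers.eval x s).v vBound = guessBound (s.v vBase) := by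
  have mul_sq := rel_loop_loop x (i := vOuter) (i' := vInner) (z := vBase) (n := s.v vBase)
    (c := mulBase ;; mulBase) (s := s) (a := 1) (f := fun a => a * s.v vBase * s.v vBase)
    (R := fun s' a => s'.v vBase = s.v vBase ∧ s'.v vBound = a)
    (fun _ _ h => h.1) (fun _ _ _ h => h) (fun _ _ _ h => h) ?_ ⟨rfl, h⟩
  · rw [powers, mul_sq.2, guessBound]
    simp only [mul_assoc, ← pow_two, mul_right_iterate, ← pow_mul, one_mul]
  · rintro s' a - ⟨hbase, rfl⟩
    refine ⟨(eval_v_of_notMem _ _ _ (by decide)).trans hbase, ?_⟩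
    rw [Cmd.eval, eval_mulBase, eval_mulBase, eval_v_of_notMem _ _ _ (by decide), hbase]

theorem eval_divMod (x : List ℕ) {s : St} (hbase : 0 < s.v vBase) (hle : s.v vGuess ≤ s.v vBound) :
    (divMod.eval x s).v vGuess = s.v vGuess % s.v vBase ∧
      (divMod.eval x s).v vQuot = s.v vGuess / s.v vBase := by
  have inv := inv_loop x (i := vT) (z := vBound) (s := s.setV vQuot 0)
    (c := ite ((var vGuess).lt (var vBase)) skip
      (set vGuess ((var vGuess).sub (var vBase)) ;; set vQuot (var vQuot + lit 1)))
    (R := fun l s' => s'.v vBase = s.v vBase ∧ s'.v vGuess + s.v vBase * s'.v vQuot = s.v vGuess ∧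
      (s'.v vGuess < s.v vBase ∨ l ≤ s'.v vQuot))
    ⟨rfl, rfl, Or.inr (Nat.zero_le _)⟩ ?_
  · obtain ⟨-, hsum, hlt⟩ : _ ∧ (divMod.eval x s).v vGuess + s.v vBase * (divMod.eval x s).v vQuot =
      s.v vGuess ∧ ((divMod.eval x s).v vGuess < s.v vBase ∨
        s.v vBound ≤ (divMod.eval x s).v vQuot) := inv
    have hlt' : (divMod.eval x s).v vGuess < s.v vBase := hlt.elim id fun h => by nlinarith
    rw [← hsum, Nat.add_mul_mod_self_left, Nat.mod_eq_of_lt hlt', Nat.add_mul_div_left _ _ hbase,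
      Nat.div_eq_of_lt hlt', zero_add]
    exact ⟨rfl, rfl⟩
  · rintro l s' - ⟨hbase', hsum, hlt⟩
    have test : ((var vGuess).lt (var vBase)).Holds x (s'.setV vT l) ↔ s'.v vGuess < s.v vBase := by
      rw [holds_lt, ← hbase']
      rfl
    rw [Cmd.eval]
    split_ifs with h
    · exact ⟨hbase', hsum, Or.inl (test.1 h)⟩
    · have hle := not_lt.1 (mt test.2 h)
      refine ⟨hbase', ?_, ?_⟩
      · change s'.v vGuess - s'.v vBase + s.v vBase * (s'.v vQuot + 1) = s.v vGuess
        rw [hbase', mul_add, mul_one]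
        omega
      · exact Or.inr (Nat.succ_le_succ (hlt.resolve_left hle.not_gt))

theorem eval_digit (x : List ℕ) {d : ℕ} {s : St} (hd : d ≠ vGuess) (hd' : d ≠ vQuot)
    (hbase : 0 < s.v vBase) (hle : s.v vGuess ≤ s.v vBound) :
    ((digit d).eval x s).v d = s.v vGuess % s.v vBase ∧
      ((digit d).eval x s).v vGuess = s.v vGuess / s.v vBase := by
  obtain ⟨hmod, hdiv⟩ := eval_divMod x hbase hle
  simp only [digit, Cmd.eval, Expr.eval, St.setV_v_self, St.setV_v_of_ne _ _ hd,
    St.setV_v_of_ne _ _ hd'.symm, hmod, hdiv, and_self]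

end MCIS

/-! ### Running the phases -/

namespace MCIS

open LoopLang LoopLang.Expr LoopLang.Cmd

section

variable {x : List ℕ} {n m : ℕ} {G : SimpleGraph (Fin n)} {H : SimpleGraph (Fin m)}
  {c : Fin n → ℕ} {d : Fin m → ℕ} {K B : ℕ} {L : List (Fin n × Fin m)} {q : Fin n × Fin m}
  {s s' : St}

/-- The state describes the graphs `G` and `H` with classes given by `c` and `d`, and the guesses
are the numbers less than `B`, written in base `K`. -/
structure Prepared (x : List ℕ) (G : SimpleGraph (Fin n)) (H : SimpleGraph (Fin m))
    (c : Fin n → ℕ) (d : Fin m → ℕ) (K B : ℕ) (s : St) : Prop where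
  graph₁ : HasGraph x false G s
  graph₂ : HasGraph x true H s
  cls₁ : ∀ u : Fin n, s.a (aCls false) u = c u
  cls₂ : ∀ v : Fin m, s.a (aCls true) v = d v
  base : s.v vBase = K
  bound : s.v vBound = B

theorem Prepared.congr (h : Prepared x G H c d K B s)
    (hv : ∀ i ∈ [vN false, vN true, vBase, vBound], s'.v i = s.v i)
    (ha : ∀ k ∈ [aRow false, aRow true, aCls false, aCls true], s'.a k = s.a k) :
    Prepared x G H c d K B s' where
  graph₁ := h.graph₁.congr (hv _ (by decide)) (ha _ (by decide))
  graph₂ := h.graph₂.congr (hv _ (by decide)) (ha _ (by decide))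
  cls₁ u := by rw [ha _ (by decide), h.cls₁]
  cls₂ v := by rw [ha _ (by decide), h.cls₂]
  base := by rw [hv _ (by decide), h.base]
  bound := by rw [hv _ (by decide), h.bound]

theorem Prepared.eval (h : Prepared x G H c d K B s) (C : Cmd)
    (hv : ∀ i ∈ [vN false, vN true, vBase, vBound], i ∉ C.writtenVars)
    (ha : ∀ k ∈ [aRow false, aRow true, aCls false, aCls true], k ∉ C.writtenArrs) :
    Prepared x G H c d K B (C.eval x s) :=
  h.congr (fun i hi => eval_v_of_notMem x C s (hv i hi))
    fun k hk => eval_a_of_notMem x C s (ha k hk)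

theorem Prepared.setV (h : Prepared x G H c d K B s) {i : ℕ} (k : ℕ)
    (hi : i ∉ [vN false, vN true, vBase, vBound]) : Prepared x G H c d K B (s.setV i k) :=
  h.congr (fun _ hj => St.setV_v_of_ne _ _ fun he => hi (he ▸ hj)) fun _ _ => rfl

/-- In addition to what `Prepared` says, the list of compatible pairs in the state is `L`. -/
structure Listing (x : List ℕ) (G : SimpleGraph (Fin n)) (H : SimpleGraph (Fin m))
    (c : Fin n → ℕ) (d : Fin m → ℕ) (K B : ℕ) (L : List (Fin n × Fin m)) (s : St) : Prop
    extends Prepared x G H c d K B s where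
  len : s.v vLen = L.length
  entries : ∀ (t : ℕ) (h : t < L.length), s.a aFst t = L[t].1 ∧ s.a aSnd t = L[t].2
  valid : Greedy.Valid G H L

theorem Listing.congr (h : Listing x G H c d K B L s)
    (hv : ∀ i ∈ [vN false, vN true, vBase, vBound, vLen], s'.v i = s.v i) (ha : s'.a = s.a) :
    Listing x G H c d K B L s' where
  toPrepared := h.toPrepared.congr (fun i hi => hv i (by revert i; decide)) fun k _ => by rw [ha]
  len := by rw [hv _ (by decide), h.len]
  entries := by rw [ha]; exact h.entries
  valid := h.valid

theorem Listing.setV (h : Listing x G H c d K B L s) {i : ℕ} (k : ℕ)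
    (hi : i ∉ [vN false, vN true, vBase, vBound, vLen]) :
    Listing x G H c d K B L (s.setV i k) :=
  h.congr (fun _ hj => St.setV_v_of_ne _ _ fun he => hi (he ▸ hj)) rfl

theorem Listing.eval (h : Listing x G H c d K B L s) (C : Cmd)
    (hv : ∀ i ∈ [vN false, vN true, vBase, vBound, vLen], i ∉ C.writtenVars)
    (ha : C.writtenArrs = []) : Listing x G H c d K B L (C.eval x s) :=
  h.congr (fun i hi => eval_v_of_notMem x C s (hv i hi))
    (funext fun _ => eval_a_of_notMem x C s (ha ▸ List.not_mem_nil))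

theorem Listing.holds_compatible (h : Listing x G H c d K B L s) (hu : s.v vU = q.1)
    (hv : s.v vV = q.2) :
    compatible.Holds x s ↔ ∀ ht : s.v vT < L.length, Greedy.Compat G H L[s.v vT] q := by
  have hlt : ((var vT).lt (var vLen)).Holds x s ↔ s.v vT < L.length := by
    rw [holds_lt, ← h.len]
    rfl
  rw [compatible, holds_not, holds_and, holds_not, not_and, not_not, hlt]
  refine forall_congr' fun ht => ?_
  obtain ⟨hfst, hsnd⟩ := h.entries _ ht
  have bits := h.graph₁.holds_bit_eq_bit h.graph₂ (e := arr aFst (var vT)) (f := var vU)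
    (e' := arr aSnd (var vT)) (f' := var vV) hfst hu hsnd hv
  rw [holds_and, holds_and, holds_not, holds_not, bits, holds_eq, holds_eq, Greedy.Compat, ne_eq,
    ne_eq, ← Fin.val_inj, ← Fin.val_inj, ← hfst, ← hsnd, ← hu, ← hv]
  rfl

theorem Listing.eval_append (h : Listing x G H c d K B L s) (hu : s.v vU = q.1)
    (hv : s.v vV = q.2) (hq : ∀ p ∈ L, Greedy.Compat G H p q) :
    Listing x G H c d K B (L ++ [q]) (append.eval x s) where
  toPrepared := h.toPrepared.eval _ (by decide) (by decide)
  len := by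
    rw [List.length_append, ← h.len]
    rfl
  entries t ht := by
    have eval_a : (append.eval x s).a = ((s.setA aFst L.length q.1).setA aSnd L.length q.2).a := by
      rw [← hu, ← hv, ← h.len]
      rfl
    rw [eval_a, St.setA_a_of_ne _ _ _ (by decide : aFst ≠ aSnd), St.setA_a, St.setA_a,
      St.setA_a_of_ne _ _ _ (by decide : aSnd ≠ aFst), List.getElem_append]
    simp only [true_and]
    split_ifs with ht' hlt hlt
    · omega
    · rw [List.getElem_singleton]
      exact ⟨rfl, rfl⟩
    · exact h.entries t hlt
    · rw [List.length_append, List.length_singleton] at ht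
      omega
  valid := List.pairwise_append.2 ⟨h.valid, List.pairwise_singleton _ _, by simpa using hq⟩

theorem Listing.eval_pairTest (h : Listing x G H c d K B L s) {t : ℕ × ℕ} (hi : s.v vI = t.1)
    (hj : s.v vJ = t.2) (hu : s.v vU = q.1) (hv : s.v vV = q.2) :
    (pairTest.eval x s).v vOk = 0 ↔ Greedy.cls c d q = t ∧ ∀ p ∈ L, Greedy.Compat G H p q := by
  set s₁ := (set vOk (((arr (aCls false) (var vU)).eq (var vI)).and
    ((arr (aCls true) (var vV)).eq (var vJ)))).eval x s
  have h₁ : Listing x G H c d K B L s₁ := h.eval _ (by decide) rfl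
  have cls_iff : s₁.v vOk = 0 ↔ Greedy.cls c d q = t := by
    refine (holds_and x s ((arr (aCls false) (var vU)).eq (var vI))
      ((arr (aCls true) (var vV)).eq (var vJ))).trans ?_
    rw [holds_eq, holds_eq]
    simp only [Expr.eval, hi, hj, hu, hv, h.cls₁, h.cls₂]
    rw [Greedy.cls, Prod.ext_iff]
  have compat_iff := v_eval_loop_and_eq_zero x (i := vT) (z := vN false) (b := vOk)
    (e := compatible) s₁ (F := fun t => ∀ ht : t < L.length, Greedy.Compat G H L[t] q)
    (by decide) fun s' hv' ha' _ =>
      (h₁.congr (fun i hi => hv' i (by revert i; decide) (by revert i; decide))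
        ha').holds_compatible ((hv' vU (by decide) (by decide)).trans hu)
          ((hv' vV (by decide) (by decide)).trans hv)
  have length_le : L.length ≤ s₁.v (vN false) := by
    simpa only [h₁.graph₁.1, List.length_map, Fintype.card_fin] using
      h.valid.nodup_fst.length_le_card
  rw [pairTest, Cmd.eval, compat_iff, cls_iff, List.forall_mem_iff_getElem]
  exact and_congr_right fun _ => ⟨fun hc t ht => hc t (ht.trans_le length_le) ht,
    fun hc t _ ht => hc t ht⟩

theorem Listing.eval_tryAdd (h : Listing x G H c d K B L s) {t : ℕ × ℕ} (hi : s.v vI = t.1)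
    (hj : s.v vJ = t.2) (hu : s.v vU = q.1) (hv : s.v vV = q.2) :
    Listing x G H c d K B (Greedy.tryAdd G H c d t L q) (tryAdd.eval x s) := by
  have test := h.eval_pairTest hi hj hu hv
  set s₁ := pairTest.eval x s
  have h₁ : Listing x G H c d K B L s₁ := h.eval _ (by decide) rfl
  have eval_eq : tryAdd.eval x s = if s₁.v vOk = 0 then append.eval x s₁ else s₁ := rfl
  rw [eval_eq, Greedy.tryAdd]
  by_cases hq : Greedy.cls c d q = t ∧ ∀ p ∈ L, Greedy.Compat G H p q
  · rw [if_pos (test.2 hq), if_pos hq]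
    exact h₁.eval_append ((eval_v_of_notMem _ _ _ (by decide)).trans hu)
      ((eval_v_of_notMem _ _ _ (by decide)).trans hv) hq.2
  · rw [if_neg (mt test.1 hq), if_neg hq]
    exact h₁

theorem Listing.eval_phase (h : Listing x G H c d K B L s) {t : ℕ × ℕ} (hi : s.v vI = t.1)
    (hj : s.v vJ = t.2) :
    Listing x G H c d K B (Greedy.phase G H c d (List.finRange n) (List.finRange m) L t)
      (phase.eval x s) := by
  refine (rel_loop x
    (R := fun s L => Listing x G H c d K B L s ∧ s.v vI = t.1 ∧ s.v vJ = t.2)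
    (f := fun L u => (List.finRange m).foldl (fun L v => Greedy.tryAdd G H c d t L (u, v)) L)
    h.graph₁.1 ⟨h, hi, hj⟩ fun s L u ⟨h, hi, hj⟩ => ?_).1
  have inner := rel_loop x (c := tryAdd) (i := vV) (z := vN true) (s := s.setV vU u) (a := L)
    (R := fun s L => Listing x G H c d K B L s ∧ s.v vI = t.1 ∧ s.v vJ = t.2 ∧ s.v vU = u)
    (f := fun L v => Greedy.tryAdd G H c d t L (u, v)) h.graph₂.1
    ⟨h.setV _ (by decide), hi, hj, rfl⟩ fun s L v ⟨h, hi, hj, hu⟩ => ⟨?_, ?_, ?_, ?_⟩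
  · exact ⟨inner.1, inner.2.1, inner.2.2.1⟩
  · exact (h.setV _ (by decide)).eval_tryAdd hi hj hu rfl
  · exact (eval_v_of_notMem _ _ _ (by decide)).trans hi
  · exact (eval_v_of_notMem _ _ _ (by decide)).trans hj
  · exact (eval_v_of_notMem _ _ _ (by decide)).trans hu

theorem Listing.eval_digits_phase (h : Listing x G H c d K B L s) (hK : 0 < K)
    (hle : s.v vGuess ≤ B) :
    ((digit vI ;; digit vJ ;; phase).eval x s).v vGuess = s.v vGuess / K / K ∧
      Listing x G H c d K B (Greedy.phase G H c d (List.finRange n) (List.finRange m) L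
        (s.v vGuess % K, s.v vGuess / K % K)) ((digit vI ;; digit vJ ;; phase).eval x s) := by
  obtain ⟨hi, hguess⟩ := eval_digit x (d := vI) (by decide) (by decide) (h.base ▸ hK)
    (h.bound ▸ hle)
  set s₁ := (digit vI).eval x s
  have h₁ : Listing x G H c d K B L s₁ := h.eval _ (by decide) rfl
  rw [h.base] at hi hguess
  obtain ⟨hj, hguess'⟩ := eval_digit x (d := vJ) (s := s₁) (by decide) (by decide) (h₁.base ▸ hK)
    (by rw [hguess, h₁.bound]; exact (Nat.div_le_self _ _).trans hle)
  set s₂ := (digit vJ).eval x s₁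
  have h₂ : Listing x G H c d K B L s₂ := h₁.eval _ (by decide) rfl
  rw [h₁.base, hguess] at hj hguess'
  exact ⟨(eval_v_of_notMem x phase s₂ (by decide)).trans hguess',
    h₂.eval_phase ((eval_v_of_notMem _ _ _ (by decide)).trans hi) hj⟩

theorem Listing.eval_phases (h : Listing x G H c d K B [] s) (hle : s.v vGuess ≤ B) :
    Listing x G H c d K B (outcome G H c d K (s.v vGuess)) (phases.eval x s) := by
  refine (rel_loop_loop x (i := vOuter) (i' := vInner) (z := vBase)
    (c := digit vI ;; digit vJ ;; phase)
    (R := fun s (a : ℕ × List (Fin n × Fin m)) =>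
      Listing x G H c d K B a.2 s ∧ s.v vGuess = a.1 ∧ a.1 ≤ B)
    (f := digitStep K (Greedy.phase G H c d (List.finRange n) (List.finRange m)))
    (fun _ _ h => h.1.base) (fun _ _ _ h => ⟨h.1.setV _ (by decide), h.2⟩)
    (fun _ _ _ h => ⟨h.1.setV _ (by decide), h.2⟩) ?_ ⟨h, rfl, hle⟩).1
  rintro s ⟨-, L⟩ hK ⟨h, rfl, hle⟩
  obtain ⟨hguess, hlist⟩ := h.eval_digits_phase hK hle
  exact ⟨hlist, hguess, ((Nat.div_le_self _ _).trans (Nat.div_le_self _ _)).trans hle⟩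

theorem Prepared.eval_trial (h : Prepared x G H c d K B s) (hle : s.v vTrial ≤ B) :
    Prepared x G H c d K B (trial.eval x s) ∧ (trial.eval x s).v vRes =
      if x.getD 2 0 ≤ (outcome G H c d K (s.v vTrial)).length then 1 else s.v vRes := by
  set s₁ := (s.setV vGuess (s.v vTrial)).setV vLen 0
  have h₁ : Listing x G H c d K B [] s₁ :=
    { toPrepared := (h.setV _ (by decide)).setV _ (by decide)
      len := rfl
      entries := fun _ ht => absurd ht (Nat.not_lt_zero _)
      valid := List.Pairwise.nil }
  have h₂ := h₁.eval_phases hle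
  set s₂ := phases.eval x s₁
  have test : ((var vLen).lt (inp (lit 2))).Holds x s₂ ↔
      ¬ x.getD 2 0 ≤ (outcome G H c d K (s.v vTrial)).length := by
    rw [holds_lt, not_le]
    exact iff_of_eq (congrArg (· < x.getD 2 0) h₂.len)
  have eval_eq : trial.eval x s = if ((var vLen).lt (inp (lit 2))).Holds x s₂ then s₂
      else s₂.setV vRes 1 := rfl
  refine ⟨h.eval _ (by decide) (by decide), ?_⟩
  by_cases hacc : x.getD 2 0 ≤ (outcome G H c d K (s.v vTrial)).length
  · rw [eval_eq, if_neg (test.not_left.2 hacc), if_pos hacc, St.setV_v_self]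
  · rw [eval_eq, if_pos (test.2 hacc), if_neg hacc]
    exact eval_v_of_notMem _ _ _ (by decide)

open Classical in
theorem Prepared.eval_search (h : Prepared x G H c d K B s) (h0 : s.v vRes = 0) :
    (search.eval x s).v vRes =
      if ∃ g < B, x.getD 2 0 ≤ (outcome G H c d K g).length then 1 else 0 := by
  have inv := inv_loop x (i := vTrial) (z := vBound) (s := s) (c := trial)
    (R := fun l s' => Prepared x G H c d K B s' ∧ s'.v vRes =
      if ∃ g < l, x.getD 2 0 ≤ (outcome G H c d K g).length then 1 else 0) ⟨h, by simp [h0]⟩ ?_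
  · rw [h.bound] at inv
    exact inv.2
  rintro l s' hl ⟨h', hres⟩
  have h₁ : Prepared x G H c d K B (s'.setV vTrial l) := h'.setV _ (by decide)
  obtain ⟨h₂, hres₂⟩ := h₁.eval_trial (h.bound ▸ hl.le)
  refine ⟨h₂, ?_⟩
  rw [hres₂, St.setV_v_self, St.setV_v_of_ne _ _ (by decide), hres, ← ite_or]
  exact if_congr (by rw [Nat.exists_lt_succ_right, or_comm]) rfl rfl

end

end MCIS

/-! ### Correctness and running time -/

theorem Greedy.exists_isIndContained_iff {V W : Type*} (G : SimpleGraph V) (H : SimpleGraph W)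
    (h : ℕ) :
    (∃ (k : ℕ) (F : SimpleGraph (Fin k)), h ≤ k ∧ F.IsIndContained G ∧ F.IsIndContained H) ↔
      ∃ L, Valid G H L ∧ h ≤ L.length := by
  constructor
  · rintro ⟨k, F, hk, ⟨φ⟩, ⟨ψ⟩⟩
    refine ⟨List.ofFn fun t => (φ t, ψ t), List.pairwise_ofFn.2 fun s t hst => ?_, by
      rwa [List.length_ofFn]⟩
    exact ⟨φ.injective.ne hst.ne, ψ.injective.ne hst.ne, φ.map_adj_iff.trans ψ.map_adj_iff.symm⟩
  · rintro ⟨L, hL, hle⟩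
    have compat {s t : Fin L.length} (hst : s ≠ t) : Compat G H (L.get s) (L.get t) :=
      hst.lt_or_gt.elim (List.pairwise_iff_get.1 hL s t)
        fun hts => symm (List.pairwise_iff_get.1 hL t s hts)
    have inj₁ : Function.Injective fun t => (L.get t).1 :=
      fun s t => not_imp_not.1 fun hst => (compat hst).1
    have inj₂ : Function.Injective fun t => (L.get t).2 :=
      fun s t => not_imp_not.1 fun hst => (compat hst).2.1
    refine ⟨L.length, G.comap fun t => (L.get t).1, hle, ⟨⟨⟨_, inj₁⟩, Iff.rfl⟩⟩,
      ⟨⟨⟨_, inj₂⟩, fun {s t} => ?_⟩⟩⟩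
    obtain rfl | hst := eq_or_ne s t
    · exact iff_of_false (H.loopless.irrefl _) (G.loopless.irrefl _)
    · exact (compat hst).2.2.symm

namespace MCIS

theorem length_adjBits {n : ℕ} (G : SimpleGraph (Fin n)) : (adjBits G).length = n * n :=
  List.length_ofFn

open Classical in
theorem getD_append_adjBits {n : ℕ} (G : SimpleGraph (Fin n)) (l l' : List ℕ) (u w : Fin n) :
    (l ++ adjBits G ++ l').getD (l.length + n * u + w) 0 = if G.Adj u w then 1 else 0 := by
  have index : n * u + w = (finProdFinEquiv (u, w) : ℕ) := add_comm _ _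
  have hlt : n * u + w < (adjBits G).length := by
    rw [index, length_adjBits]
    exact Fin.is_lt _
  rw [List.append_assoc, List.getD_eq_getElem?_getD, add_assoc,
    List.getElem?_append_right (Nat.le_add_right _ _), Nat.add_sub_cancel_left,
    List.getElem?_append_left hlt, index, adjBits, List.getElem?_ofFn, dif_pos (Fin.is_lt _)]
  change (if G.Adj (finProdFinEquiv.symm (finProdFinEquiv (u, w))).1
    (finProdFinEquiv.symm (finProdFinEquiv (u, w))).2 then 1 else 0) = _
  rw [Equiv.symm_apply_apply]

theorem length_le_inputSize (x : List ℕ) : x.length ≤ RAM.inputSize x := by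
  have := List.length_le_sum_of_one_le (x.map fun a => Nat.size a + 1) (by simp)
  simpa only [RAM.inputSize, List.length_map] using this

theorem le_inputSize (i : MCISInstance) :
    1 ≤ RAM.inputSize i.encode ∧ i.n₁ ≤ RAM.inputSize i.encode ∧
      i.n₂ ≤ RAM.inputSize i.encode := by
  have h := length_le_inputSize i.encode
  simp only [MCISInstance.encode, List.length_append, length_adjBits, List.length_cons,
    List.length_nil] at h ⊢
  have h₁ := Nat.le_mul_self i.n₁
  have h₂ := Nat.le_mul_self i.n₂
  omega

open LoopLang LoopLang.Expr LoopLang.Cmd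

section

variable {x : List ℕ} {n m : ℕ} {G : SimpleGraph (Fin n)} {H : SimpleGraph (Fin m)} {s : St}

open Classical in
theorem hasGraph_eval_rows {b : Bool} (hn : s.v (vN b) = n)
    (hx : ∀ u w : Fin n, x.getD (s.v vRow + n * u + w) 0 = if G.Adj u w then 1 else 0) :
    HasGraph x b G ((rows b).eval x s) := by
  refine ⟨(eval_v_of_notMem _ _ _ (by cases b <;> decide)).trans hn, fun u w => ?_⟩
  rw [(eval_rows x b s).2 u (hn ▸ u.2), hn, hx]

theorem Classified.eval {b : Bool} {j : ℕ} (h : Classified x b G j s) (c : Cmd)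
    (hv : vN b ∉ c.writtenVars) (hv' : vNum b ∉ c.writtenVars) (ha : aRow b ∉ c.writtenArrs)
    (ha' : aCls b ∉ c.writtenArrs) : Classified x b G j (c.eval x s) where
  graph := h.graph.eval c hv ha
  numbering := by
    rw [eval_v_of_notMem x c s hv', eval_a_of_notMem x c s ha']
    exact h.numbering

open Classical in
theorem classified_eval_prepare (hn : s.v (vN false) = n) (hm : s.v (vN true) = m)
    (hk : s.v (vNum false) = 0) (hk' : s.v (vNum true) = 0)
    (hG : ∀ u w : Fin n, x.getD (s.v vRow + n * u + w) 0 = if G.Adj u w then 1 else 0)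
    (hH : ∀ v w : Fin m, x.getD (s.v vRow + n * n + m * v + w) 0 = if H.Adj v w then 1 else 0) :
    Classified x false G n (prepare.eval x s) ∧ Classified x true H m (prepare.eval x s) := by
  have hG₁ := hasGraph_eval_rows hn hG
  have hrow := (eval_rows x false s).1
  set s₁ := (rows false).eval x s
  have hm₁ : s₁.v (vN true) = m := (eval_v_of_notMem _ _ _ (by decide)).trans hm
  have hH₂ : HasGraph x true H ((rows true).eval x s₁) :=
    hasGraph_eval_rows hm₁ (by rw [hrow, hn]; exact hH)
  have hG₂ := hG₁.eval (rows true) (by decide) (by decide)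
  set s₂ := (rows true).eval x s₁
  have num₂ (b) (hb : s.v (vNum b) = 0) : s₂.v (vNum b) = 0 :=
    (eval_v_of_notMem _ _ _ (by cases b <;> decide)).trans
      ((eval_v_of_notMem _ _ _ (by cases b <;> decide)).trans hb)
  have hG₃ := hG₂.eval_classify (num₂ _ hk)
  have hH₃ := hH₂.eval (classify false) (by decide) (by decide)
  exact ⟨hG₃.eval (classify true) (by decide) (by decide) (by decide) (by decide),
    hH₃.eval_classify ((eval_v_of_notMem _ _ _ (by decide)).trans (num₂ _ hk'))⟩

theorem Prepared.of_classified (hG : Classified x false G n s) (hH : Classified x true H m s) :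
    Prepared x G H (fun u => s.a (aCls false) u) (fun v => s.a (aCls true) v)
      (s.v (vNum false) + s.v (vNum true)) (guessBound (s.v (vNum false) + s.v (vNum true)))
      ((setBase ;; powers).eval x s) where
  graph₁ := hG.graph.eval (setBase ;; powers) (by decide) (by decide)
  graph₂ := hH.graph.eval (setBase ;; powers) (by decide) (by decide)
  cls₁ u := by rw [eval_a_of_notMem _ _ _ (by decide)]
  cls₂ v := by rw [eval_a_of_notMem _ _ _ (by decide)]
  base := eval_v_of_notMem x powers (setBase.eval x s) (by decide)
  bound := eval_powers x rfl

theorem Classified.twins_of_eq {b : Bool} (h : Classified x b G n s) (u u' : Fin n)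
    (hu : s.a (aCls b) u = s.a (aCls b) u') : G.Twins u u' :=
  (h.numbering.eq_iff u u.2 u' u'.2).1 hu

open Classical in
theorem eval_search_of_classified (hG : Classified x false G n s) (hH : Classified x true H m s)
    (h0 : s.v vRes = 0) : (search.eval x ((setBase ;; powers).eval x s)).v vRes =
      if ∃ L, Greedy.Valid G H L ∧ x.getD 2 0 ≤ L.length then 1 else 0 := by
  rw [(Prepared.of_classified hG hH).eval_search ((eval_v_of_notMem _ _ _ (by decide)).trans h0)]
  exact if_congr (exists_le_length_outcome_iff hG.twins_of_eq hH.twins_of_eq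
    (fun u => hG.numbering.lt u u.2) (fun v => hH.numbering.lt v v.2) _) rfl rfl

end

theorem classified_eval_prepare_encode (i : MCISInstance) :
    letI s := prepare.eval i.encode (readSizes.eval i.encode .start)
    Classified i.encode false i.G₁ i.n₁ s ∧ Classified i.encode true i.G₂ i.n₂ s := by
  refine classified_eval_prepare rfl rfl rfl rfl (getD_append_adjBits i.G₁ [i.n₁, i.n₂, i.h] _)
    fun v w => ?_
  have := getD_append_adjBits i.G₂ ([i.n₁, i.n₂, i.h] ++ adjBits i.G₁) [] v w
  rwa [List.append_nil, List.length_append, length_adjBits] at this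

open Classical in
theorem eval_program (i : MCISInstance) :
    (program.eval i.encode .start).v 0 = if i.IsYes then 1 else 0 := by
  obtain ⟨hG, hH⟩ := classified_eval_prepare_encode i
  exact (eval_search_of_classified hG hH (eval_v_of_notMem _ _ _ (by decide))).trans
    (if_congr (Greedy.exists_isIndContained_iff i.G₁ i.G₂ i.h).symm rfl rfl)

theorem cost_program_le (i : MCISInstance) :
    program.cost i.encode .start ≤ program.time (RAM.inputSize i.encode +
      (i.G₁.nd + i.G₂.nd + guessBound (i.G₁.nd + i.G₂.nd))) := by
  obtain ⟨-, hn, hm⟩ := le_inputSize i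
  obtain ⟨hG, hH⟩ := classified_eval_prepare_encode i
  have hprep := Prepared.of_classified hG hH
  have hK := add_le_add hG.numbering.le_nd hH.numbering.le_nd
  have hB := guessBound_mono hK
  refine add_le_add (cost_le_time _ _ _ (by decide) ?_) <|
    add_le_add (cost_le_time _ _ _ (by decide) ?_) <|
    add_le_add (cost_le_time _ _ _ (by decide) ?_) <|
    add_le_add (cost_le_time _ _ _ (by decide) ?_) (cost_le_time _ _ _ (by decide) ?_)
  · exact fun z hz => absurd hz List.not_mem_nil
  · intro z hz
    obtain rfl | rfl := (by decide : ∀ z ∈ prepare.loopBounds, z = vN false ∨ z = vN true) z hz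
    exacts [hn.trans (Nat.le_add_right _ _), hm.trans (Nat.le_add_right _ _)]
  · exact fun z hz => absurd hz List.not_mem_nil
  · intro z hz
    obtain rfl := (by decide : ∀ z ∈ powers.loopBounds, z = vBase) z hz
    exact hK.trans ((Nat.le_add_right _ _).trans (Nat.le_add_left _ _))
  · intro z hz
    obtain rfl | rfl | rfl | rfl := (by decide : ∀ z ∈ search.loopBounds,
      z = vN false ∨ z = vN true ∨ z = vBase ∨ z = vBound) z hz
    · exact hprep.graph₁.1.trans_le (hn.trans (Nat.le_add_right _ _))
    · exact hprep.graph₂.1.trans_le (hm.trans (Nat.le_add_right _ _))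
    · exact hprep.base.trans_le (hK.trans ((Nat.le_add_right _ _).trans (Nat.le_add_left _ _)))
    · exact hprep.bound.trans_le (hB.trans ((Nat.le_add_left _ _).trans (Nat.le_add_left _ _)))

theorem computable_timeFactor (C D : ℕ) :
    Computable fun κ : ℕ => C * (κ + guessBound κ + 2) ^ D := by
  have hpow : Primrec₂ fun a b : ℕ => a ^ b := Primrec₂.unpaired'.1 Nat.Primrec.pow
  have hbound : Primrec guessBound := hpow.comp Primrec.id
    (Primrec.nat_mul.comp (Primrec.const 2) (Primrec.nat_mul.comp Primrec.id Primrec.id))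
  exact (Primrec.nat_mul.comp (Primrec.const C) (hpow.comp (Primrec.nat_add.comp
    (Primrec.nat_add.comp Primrec.id hbound) (Primrec.const 2)) (Primrec.const D))).to_comp

end MCIS

theorem mainTheorem4 :
    IsFPT MCISInstance.encode MCISInstance.IsYes (fun i => i.G₁.nd + i.G₂.nd) := by
  obtain ⟨C, D, hCD⟩ := MCIS.program.exists_time_le
  refine ⟨MCIS.program.compile 0 0, _, D, MCIS.computable_timeFactor C D, fun i => ?_⟩
  have heval := MCIS.eval_program i
  have hcost := (MCIS.cost_program_le i).trans (hCD _)
  have hN : 1 ≤ RAM.inputSize i.encode := (MCIS.le_inputSize i).1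
  generalize MCIS.program = P at heval hcost ⊢
  generalize i.G₁.nd + i.G₂.nd + MCIS.guessBound (i.G₁.nd + i.G₂.nd) = A at hcost ⊢
  have hbase : RAM.inputSize i.encode + A + 1 ≤ (A + 2) * RAM.inputSize i.encode := by nlinarith
  have hcost' : P.cost i.encode .start ≤ C * (A + 2) ^ D * RAM.inputSize i.encode ^ D := by
    rw [mul_assoc, ← mul_pow]
    exact hcost.trans (Nat.mul_le_mul_left C (Nat.pow_le_pow_left hbase D))
  exact ⟨fun h => P.outputsWithin_compile _ hcost' (heval.trans (if_pos h)),
    fun h => P.outputsWithin_compile _ hcost' (heval.trans (if_neg h))⟩
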